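/- Setting. Qubits sit on the vertices of a finite connected graph $G$ with graph metric $d$. A protocol consists of a circuit $\mathcal U$ of depth $T$ (each layer is a product of unitary gates on disjoint sets of sites, each set of diameter at most $v$), of $N$ measurements of nontrivial single-qubit observables $A'_1,\dots,A'_N$ on sites $j_1,\dots,j_N$, each made after some number of the layers, and of recovery operations. Let $\tau_n$ be the number of layers that follow measurement $n$, and let $A_n=C_n\bar A'_nC_n^\dagger$ be its canonical-form observable, where $\bar A'_n$ is the involutory part of $A'_n$ (same eigenvectors, eigenvalues $\pm1$) and $C_n$ is the product of the layers after the measurement. In canonical form the protocol is the unitary $\mathcal W=\mathcal R\,\mathcal M\,\mathcal U$ on the physical qubits and $N$ outcome (Stinespring) qubits initialized in $|0\rangle$: $\mathcal M$ is the ordered product of the measurement unitaries $\tfrac{1}{2}(1+A_n)\otimes 1+\tfrac{1}{2}(1-A_n)\otimes\widetilde X_n$, and $\mathcal R$ is a product of Pauli strings, each applied if the sum of the outcomes in some set is odd. The protocol is a *standard teleportation protocol* of one qubit from site $i$ to site $f$ if, for a fixed product state on the sites other than $i$, every logical state $|\psi\rangle$ on $i$ is mapped to $|\psi\rangle$ on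 $f$ in a product with one state $\Phi$ of all other physical and outcome qubits, where $\Phi$ does not depend on $\psi$; no layer acts on a site after that site has been measured; and $L=d(i,f)>vT$. (a) If a standard teleportation protocol has $N=2$ measurements with $A_1\ne A_2$ and $[A_1,A_2]=0$, then $T\ge2$ and $$L\le v(3T-2)-2v\max(\tau_1,\tau_2).$$ (b) Every standard teleportation protocol with $N$ measurements has $T\ge2$ and $$L\le vT+2v\lfloor N/2\rfloor(T-1).$$ Moreover, measurement pairs are spaced at most $2v(T-1)$ apart, in the following sense: for some $M$ with $1\le M\le\lfloor N/2\rfloor$ there are $M$ pairs of measurements, all $2M$ of them on different sites, and for each of these measurements a position, which is a site acted on by the same gate as the measured site in the last layer before the measurement, such that both positions of the first pair are within $v(T-1)$ of $i$, each position of a later pair is within $2v(T-1)$ of a position of the preceding pair, and some position of the last pair is within $v(2T-1)$ of $f$. -/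

import Mathlib

open scoped Kronecker Matrix

noncomputable section

namespace Teleport

/-- Operators on the Hilbert space of the qubits labelled by `ι`, in the computational basis. -/
abbrev QOp (ι : Type*) := Matrix (ι → Fin 2) (ι → Fin 2) ℂ

/-- The single-qubit Pauli matrices `1, X, Y, Z`. -/
def pauli : Fin 4 → Matrix (Fin 2) (Fin 2) ℂ :=
  ![1, !![0, 1; 1, 0], !![0, -Complex.I; Complex.I, 0], !![1, 0; 0, -1]]

/-- The tensor product over all qubits of the single-qubit operators `a k`. -/
def tensorOp {ι : Type*} [Fintype ι] (a : ι → Matrix (Fin 2) (Fin 2) ℂ) : QOp ι :=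
  Matrix.of fun x y => ∏ k, a k (x k) (y k)

/-- The single-qubit operator `a` acting on qubit `k`, the identity elsewhere. -/
def onSite {ι : Type*} [Fintype ι] [DecidableEq ι] (k : ι) (a : Matrix (Fin 2) (Fin 2) ℂ) :
    QOp ι :=
  tensorOp (Function.update (fun _ => 1) k a)

/-- The product state with the qubit `k` in the state `φ k`. -/
def prodState {ι : Type*} [Fintype ι] (φ : ι → Fin 2 → ℂ) : (ι → Fin 2) → ℂ :=
  fun x => ∏ k, φ k (x k)

/-- One layer of a quantum circuit: the sites are partitioned into the fibres of `block`, and on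
each block acts an arbitrary unitary gate. Any two sites in a common gate are at graph distance
at most `v`. A site that no gate touches is a block of its own, with the identity as gate. -/
structure Layer {V : Type*} [Fintype V] [DecidableEq V] (G : SimpleGraph V) (v : ℕ) where
  block : V → V
  gate : ∀ b : V,
    Matrix ({x // block x = b} → Fin 2) ({x // block x = b} → Fin 2) ℂ
  gate_unitary : ∀ b : V, gate b ∈ Matrix.unitaryGroup ({x // block x = b} → Fin 2) ℂ
  dist_le : ∀ x y : V, block x = block y → G.dist x y ≤ v

namespace Layer

variable {V : Type*} [Fintype V] [DecidableEq V] {G : SimpleGraph V} {v : ℕ}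

/-- The unitary of a layer: the tensor product of its gates. -/
def op (l : Layer G v) : QOp V :=
  Matrix.of fun x y => ∏ b, l.gate b (fun s => x s) (fun s => y s)

/-- The layer applies no unitary to the site `j`. -/
def Idle (l : Layer G v) (j : V) : Prop :=
  (∀ x, l.block x = l.block j → x = j) ∧ l.gate (l.block j) = 1

end Layer

/-- A nontrivial observable of one qubit: Hermitian, with the two distinct real eigenvalues
`lo < hi`. -/
structure QubitObservable where
  mat : Matrix (Fin 2) (Fin 2) ℂ
  hi : ℝ
  lo : ℝ
  lo_lt_hi : lo < hi
  isHermitian : mat.IsHermitian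
  annihilate : (mat - (hi : ℂ) • 1) * (mat - (lo : ℂ) • 1) = 0
  ne_hi : mat ≠ (hi : ℂ) • 1
  ne_lo : mat ≠ (lo : ℂ) • 1

/-- The involutory part of a single-qubit observable: same eigenvectors, eigenvalues `±1`. -/
def QubitObservable.inv (A : QubitObservable) : Matrix (Fin 2) (Fin 2) ℂ :=
  ((A.hi : ℂ) - A.lo)⁻¹ • ((2 : ℂ) • A.mat - ((A.hi : ℂ) + A.lo) • 1)

/-- A protocol with a circuit of depth `T` whose gates have range at most `v`, with `N`
measurements of single-qubit observables, and with outcome-dependent Pauli operations.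

Measurement `n` is made on the site `site n`, after the first `time n` layers. Every element
`(Ω, χ)` of `recovery` is a recovery operation in the canonical form of the protocol: the Pauli
string `χ` is applied if the sum of the outcomes in `Ω` is odd. -/
structure Protocol {V : Type*} [Fintype V] [DecidableEq V] (G : SimpleGraph V) (v T N : ℕ) where
  layer : Fin T → Layer G v
  site : Fin N → V
  time : Fin N → ℕ
  time_le : ∀ n, time n ≤ T
  time_mono : Monotone time
  obs : Fin N → QubitObservable
  recovery : List (Finset (Fin N) × (V → Fin 4))

namespace Protocol

variable {V : Type*} [Fintype V] [DecidableEq V] {G : SimpleGraph V} {v T N : ℕ}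

/-- The product of the layers that act after the first `t` layers; later layers stand on the
left. -/
def after (P : Protocol G v T N) (t : ℕ) : QOp V :=
  ((List.ofFn fun s => (P.layer s).op).drop t).reverse.prod

/-- The unitary of the whole circuit. -/
def circuit (P : Protocol G v T N) : QOp V := P.after 0

/-- The depth of the circuit that remains after measurement `n`. -/
def tau (P : Protocol G v T N) (n : Fin N) : ℕ := T - P.time n

/-- The (involutory) observable of measurement `n` in canonical form: the single-qubit observable,
conjugated by all unitaries that follow its measurement. -/
def canonicalObs (P : Protocol G v T N) (n : Fin N) : QOp V :=
  P.after (P.time n) * onSite (P.site n) (P.obs n).inv * (P.after (P.time n))ᴴ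

/-- The Stinespring unitary of measurement `n`: the outcome `0` (eigenvalue `+1`) or `1`
(eigenvalue `-1`) is added to the Stinespring qubit `n`. -/
def measure (P : Protocol G v T N) (n : Fin N) :
    Matrix ((V → Fin 2) × (Fin N → Fin 2)) ((V → Fin 2) × (Fin N → Fin 2)) ℂ :=
  ((2⁻¹ : ℂ) • (1 + P.canonicalObs n)) ⊗ₖ (1 : QOp (Fin N)) +
    ((2⁻¹ : ℂ) • (1 - P.canonicalObs n)) ⊗ₖ (onSite n (pauli 1) : QOp (Fin N))

/-- The product of the Stinespring `Z` operators in `Ω`. -/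
def ssParity (Ω : Finset (Fin N)) : QOp (Fin N) :=
  tensorOp fun n => if n ∈ Ω then pauli 3 else 1

/-- The controlled Pauli operation: `χ` is applied if the outcome parity of `Ω` is odd. -/
def recoveryOp (r : Finset (Fin N) × (V → Fin 4)) :
    Matrix ((V → Fin 2) × (Fin N → Fin 2)) ((V → Fin 2) × (Fin N → Fin 2)) ℂ :=
  (1 : QOp V) ⊗ₖ ((2⁻¹ : ℂ) • (1 + ssParity r.1)) +
    (tensorOp fun x => pauli (r.2 x)) ⊗ₖ ((2⁻¹ : ℂ) • (1 - ssParity r.1))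

/-- The protocol as a unitary on the dilated space, in canonical form: the circuit, then all
measurements in their order, then all recovery operations. -/
def dilated (P : Protocol G v T N) :
    Matrix ((V → Fin 2) × (Fin N → Fin 2)) ((V → Fin 2) × (Fin N → Fin 2)) ℂ :=
  (P.recovery.map recoveryOp).prod * (List.ofFn P.measure).reverse.prod *
    (P.circuit ⊗ₖ (1 : QOp (Fin N)))

/-- The initial state: `ψ` on the site `i`, the states `φ k` on the other sites `k`, and all
Stinespring qubits in the state `0`. -/
def initial (φ : V → Fin 2 → ℂ) (i : V) (ψ : Fin 2 → ℂ) :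
    (V → Fin 2) × (Fin N → Fin 2) → ℂ :=
  fun z => prodState (Function.update φ i ψ) z.1 * if z.2 = 0 then 1 else 0

/-- The protocol maps `ψ` on `i` to `ψ` on `f`, for every normalized `ψ`: the final state is the
product of `ψ` on `f` and of a state `Φ` of all other physical and Stinespring qubits. -/
def Transfers (P : Protocol G v T N) (φ : V → Fin 2 → ℂ) (i f : V) : Prop :=
  ∃ Φ : ({x : V // x ≠ f} → Fin 2) → (Fin N → Fin 2) → ℂ,
    ∀ ψ : Fin 2 → ℂ, ∑ b, ‖ψ b‖ ^ 2 = 1 →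
      P.dilated *ᵥ initial φ i ψ = fun z => ψ (z.1 f) * Φ (fun x => z.1 x) z.2

/-- Standard teleportation of one qubit from `i` to `f`: the initial state is a (normalized)
product state, the logical qubit is transferred, no unitary acts on a site that has been measured,
and the distance exceeds what the circuit can achieve without measurements. -/
structure IsStandardTeleportation (P : Protocol G v T N) (φ : V → Fin 2 → ℂ) (i f : V) :
    Prop where
  normalized : ∀ k, k ≠ i → ∑ b, ‖φ k b‖ ^ 2 = 1
  transfers : P.Transfers φ i f
  untouched : ∀ (n : Fin N) (t : Fin T), P.time n ≤ t → (P.layer t).Idle (P.site n)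
  lt_dist : v * T < G.dist i f

/-- The sites in the gate that acts on the measured qubit in the last layer before measurement
`n`. -/
def lastGate (P : Protocol G v T N) (n : Fin N) : Set V :=
  {x | ∃ t : Fin T, (t : ℕ) + 1 = P.time n ∧
    (P.layer t).block x = (P.layer t).block (P.site n)}

/-- A daisy chain of `M` pairs of measurements from `i` to `f`. The `2 * M` measurements
`m s b` are made on different sites. Their positions `y s b` are taken up to the last gate before
the measurement. Both members of the first pair are within `v * (T - 1)` of `i`, each member of a
later pair is within `2 * v * (T - 1)` of a member of the pair before it, and a member of the last
pair is within `v * (2 * T - 1)` of `f`. -/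
def HasPairChain (P : Protocol G v T N) (i f : V) (M : ℕ) : Prop :=
  ∃ (m : Fin M → Fin 2 → Fin N) (y : Fin M → Fin 2 → V),
    Function.Injective (fun a : Fin M × Fin 2 => P.site (m a.1 a.2)) ∧
    (∀ s b, y s b ∈ P.lastGate (m s b)) ∧
    (∀ s : Fin M, (s : ℕ) = 0 → ∀ b, G.dist i (y s b) ≤ v * (T - 1)) ∧
    (∀ s s' : Fin M, (s' : ℕ) = s + 1 →
      ∀ b, ∃ b', G.dist (y s b') (y s' b) ≤ 2 * v * (T - 1)) ∧
    (∀ s : Fin M, (s : ℕ) + 1 = M → ∃ b, G.dist (y s b) f ≤ v * (2 * T - 1))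

end Protocol

end Teleport

end

noncomputable section

namespace Teleport

/-! ### Tensor products of single-qubit operators and operators local to a set of qubits. -/

section TensorOp

variable {ι : Type*} [Fintype ι]

/-! The proof is a light-cone argument for logical operators. Recovery operations are Pauli strings,
so moving a Pauli operator on `f` back through them costs only signs of outcomes. On each
measurement branch these signs combine with the eigenprojectors. Hence, between the circuit and the
measurements, every logical Pauli operator is realized by the same Pauli operator on `f` times, on
each measured site `j`, one of `±1, ±A j`, where `A j` is an involution independent of the Pauli
operator (`exists_logical`).

The core is `not_separated`. Let `D` contain `i` and miss the backward light cone of `f`, and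
suppose that every measured site except one, `j`, has its cone inside `D` or outside `D`. Of the
logical operators X, Z and XZ, one acts trivially on `j`; pulled back through the circuit, it is an
operator on `D` times an operator on the complement. The initial state is a product, so the factor
on `D` alone implements the logical operator up to scalars. That factor consists only of the
commuting `A k`, away from `f`, so it commutes with the realization of an anticommuting logical
operator, which is absurd. Therefore every such `D` is straddled by the cones of two measurements on
different sites (`exists_straddling_pair`).

For two measurements, both must straddle the block of `i` in the first layer and the complement of
the cone of `f`; this yields (a). In general, let `region` grow from the block of `i` by adjoining
all cones that meet it. Until the cone of `f` is met, each step supplies a new straddling pair, and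
each member of a pair has a cone that meets that of a measurement straddling the previous region.
This gives the chain, with at most `N / 2` pairs because its sites are distinct.

The constants come from counting gates. Two meeting cones share one gate of the first layer, and
positions are taken at the last gate before the measurement, so these gates are not counted twice.
-/

theorem tensorOp_apply (a : ι → Matrix (Fin 2) (Fin 2) ℂ) (x y : ι → Fin 2) :
    tensorOp a x y = ∏ k, a k (x k) (y k) := rfl

theorem tensorOp_smul (c : ι → ℂ) (a : ι → Matrix (Fin 2) (Fin 2) ℂ) :
    tensorOp (fun j => c j • a j) = (∏ j, c j) • tensorOp a := by
  ext x y
  simp only [Matrix.smul_apply, tensorOp_apply, smul_eq_mul, Finset.prod_mul_distrib]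

theorem tensorOp_one : tensorOp (fun _ : ι => (1 : Matrix (Fin 2) (Fin 2) ℂ)) = 1 := by
  ext x y
  rw [tensorOp_apply, Matrix.one_apply]
  split_ifs with h
  · subst h; simp
  · obtain ⟨k, hk⟩ := Function.ne_iff.1 h
    exact Finset.prod_eq_zero (Finset.mem_univ k) (by simp [hk])

theorem tensorOp_single (p q : ι → Fin 2) :
    tensorOp (fun s => Matrix.single (p s) (q s) (1 : ℂ)) = Matrix.single p q 1 := by
  ext x y
  rw [tensorOp_apply, Matrix.single_apply]
  simp only [Matrix.single_apply, Finset.prod_ite_zero, Finset.mem_univ, true_implies,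
    Finset.prod_const_one, funext_iff, forall_and]

variable [DecidableEq ι]

theorem tensorOp_mul (a b : ι → Matrix (Fin 2) (Fin 2) ℂ) :
    tensorOp a * tensorOp b = tensorOp fun k => a k * b k := by
  ext x y
  simp only [Matrix.mul_apply, tensorOp_apply, Finset.prod_univ_sum, Fintype.piFinset_univ,
    Finset.prod_mul_distrib]

theorem tensorOp_commute {a b : ι → Matrix (Fin 2) (Fin 2) ℂ} (h : ∀ k, Commute (a k) (b k)) :
    Commute (tensorOp a) (tensorOp b) := by
  rw [commute_iff_eq, tensorOp_mul, tensorOp_mul]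
  congr 1
  funext k
  exact h k

theorem onSite_apply (k : ι) (a : Matrix (Fin 2) (Fin 2) ℂ) (x y : ι → Fin 2) :
    onSite k a x y =
      a (x k) (y k) * ∏ j ∈ Finset.univ.erase k, (1 : Matrix (Fin 2) (Fin 2) ℂ) (x j) (y j) := by
  rw [onSite, tensorOp_apply, ← Finset.mul_prod_erase _ _ (Finset.mem_univ k),
    Function.update_self]
  congr 1
  refine Finset.prod_congr rfl fun j hj => ?_
  rw [Function.update_of_ne (Finset.ne_of_mem_erase hj)]

theorem onSite_add (k : ι) (a b : Matrix (Fin 2) (Fin 2) ℂ) :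
    onSite k (a + b) = onSite k a + onSite k b := by
  ext x y
  simp only [Matrix.add_apply, onSite_apply, add_mul]

theorem onSite_smul (k : ι) (c : ℂ) (a : Matrix (Fin 2) (Fin 2) ℂ) :
    onSite k (c • a) = c • onSite k a := by
  ext x y
  simp only [Matrix.smul_apply, onSite_apply, smul_eq_mul, mul_assoc]

theorem onSite_neg (k : ι) (a : Matrix (Fin 2) (Fin 2) ℂ) : onSite k (-a) = -onSite k a := by
  simpa using onSite_smul k (-1) a

theorem onSite_mul (k : ι) (a b : Matrix (Fin 2) (Fin 2) ℂ) :
    onSite k a * onSite k b = onSite k (a * b) := by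
  rw [onSite, onSite, onSite, tensorOp_mul]
  congr 1
  funext j
  by_cases h : j = k
  · subst h; simp
  · simp [h]

theorem onSite_one (k : ι) : onSite k (1 : Matrix (Fin 2) (Fin 2) ℂ) = 1 := by
  rw [onSite, Function.update_eq_self, tensorOp_one]

theorem onSite_mulVec (k : ι) (a : Matrix (Fin 2) (Fin 2) ℂ) (g : (ι → Fin 2) → ℂ)
    (x : ι → Fin 2) :
    (onSite k a *ᵥ g) x = ∑ c, a (x k) c * g (Function.update x k c) := by
  have key : ∀ y, onSite k a x y =
      ∑ c, a (x k) c * if y = Function.update x k c then 1 else 0 := by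
    intro y
    rw [onSite, tensorOp_apply, ← Finset.mul_prod_erase _ _ (Finset.mem_univ k)]
    by_cases h : ∀ j ≠ k, x j = y j
    · have hy : ∀ c, y = Function.update x k c ↔ c = y k := by
        intro c
        constructor
        · intro h; rw [h]; simp
        · rintro rfl
          funext j
          by_cases hj : j = k
          · subst hj; simp
          · simp [hj, h j hj]
      rw [Finset.prod_eq_one]
      · simp [hy]
      · intro j hj
        have hj := Finset.ne_of_mem_erase hj
        simp [hj, h j hj]
    · push Not at h
      obtain ⟨j, hj, hxy⟩ := h
      rw [Finset.prod_eq_zero (i := j) (by simp [hj]) (by simp [hj, hxy]), mul_zero, eq_comm]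
      refine Finset.sum_eq_zero fun c _ => ?_
      rw [if_neg, mul_zero]
      rintro rfl
      simp [hj] at hxy
  rw [Matrix.mulVec, dotProduct]
  simp only [key, Finset.sum_mul]
  rw [Finset.sum_comm]
  refine Finset.sum_congr rfl fun c _ => ?_
  rw [Finset.sum_eq_single (Function.update x k c)]
  · simp
  · intro b _ hb; simp [hb]
  · simp

/-- A property of operators that is closed under products holds for a tensor product of
single-qubit operators if it holds for each of them. -/
theorem tensorOp_induction {p : QOp ι → Prop} (one : p 1) (mul : ∀ A B, p A → p B → p (A * B))
    (c : ι → Matrix (Fin 2) (Fin 2) ℂ) (h : ∀ k, p (onSite k (c k))) : p (tensorOp c) := by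
  have key : ∀ S : Finset ι, p (tensorOp fun k => if k ∈ S then c k else 1) := by
    intro S
    induction S using Finset.induction_on with
    | empty => simpa [tensorOp_one] using one
    | insert k S hk ih =>
      convert mul _ _ (h k) ih using 1
      rw [onSite, tensorOp_mul]
      congr 1
      funext j
      by_cases hj : j = k
      · subst hj; simp [hk]
      · simp [hj]
  simpa using key Finset.univ

/-- The algebra of the operators that act on the qubits in `D` only. -/
def localAlg (D : Set ι) : Subalgebra ℂ (QOp ι) :=
  Algebra.adjoin ℂ {A | ∃ k ∈ D, ∃ a, A = onSite k a}

theorem onSite_mem_localAlg {D : Set ι} {k : ι} (hk : k ∈ D) (a : Matrix (Fin 2) (Fin 2) ℂ) :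
    onSite k a ∈ localAlg D :=
  Algebra.subset_adjoin ⟨k, hk, a, rfl⟩

theorem localAlg_mono {D E : Set ι} (h : D ⊆ E) : localAlg D ≤ localAlg E :=
  Algebra.adjoin_mono fun _ ⟨k, hk, a, e⟩ => ⟨k, h hk, a, e⟩

/-- An operator on `D` maps a product of a state on `D` and a state on the complement of `D` to
such a product, and does not change the second factor. -/
theorem localAlg_mulVec_mul {D : Set ι} {A : QOp ι} (hA : A ∈ localAlg D)
    (α : (ι → Fin 2) → ℂ) (hα : ∀ x y, (∀ k ∈ D, x k = y k) → α x = α y) :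
    ∃ α' : (ι → Fin 2) → ℂ, (∀ x y, (∀ k ∈ D, x k = y k) → α' x = α' y) ∧
      ∀ β : (ι → Fin 2) → ℂ, (∀ x y, (∀ k ∉ D, x k = y k) → β x = β y) →
        (A *ᵥ fun x => α x * β x) = fun x => α' x * β x := by
  induction hA using Algebra.adjoin_induction generalizing α with
  | mem A h =>
    obtain ⟨k, hk, a, rfl⟩ := h
    refine ⟨fun x => ∑ c, a (x k) c * α (Function.update x k c), ?_, ?_⟩
    · intro x y h
      simp only
      rw [h k hk]
      refine Finset.sum_congr rfl fun c _ => ?_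
      congr 1
      refine hα _ _ fun j hj => ?_
      by_cases e : j = k
      · subst e; simp
      · simp [e, h j hj]
    · intro β hβ
      funext x
      rw [onSite_mulVec, Finset.sum_mul]
      refine Finset.sum_congr rfl fun c _ => ?_
      rw [hβ (Function.update x k c) x, mul_assoc]
      intro j hj
      rw [Function.update_of_ne]
      rintro rfl
      exact hj hk
  | algebraMap r =>
    refine ⟨fun x => r * α x, fun x y h => by simp only [hα x y h], fun β _ => ?_⟩
    rw [Algebra.algebraMap_eq_smul_one, Matrix.smul_mulVec, Matrix.one_mulVec]
    funext x
    simp [mul_assoc]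
  | add A B _ _ ihA ihB =>
    obtain ⟨α₁, h₁, e₁⟩ := ihA α hα
    obtain ⟨α₂, h₂, e₂⟩ := ihB α hα
    refine ⟨fun x => α₁ x + α₂ x, fun x y h => by simp only [h₁ x y h, h₂ x y h], fun β hβ => ?_⟩
    rw [Matrix.add_mulVec, e₁ β hβ, e₂ β hβ]
    funext x
    simp [add_mul]
  -- The new first factor does not depend on `β`, so the two induction hypotheses can be chained.
  | mul A B _ _ ihA ihB =>
    obtain ⟨α₁, h₁, e₁⟩ := ihB α hα
    obtain ⟨α₂, h₂, e₂⟩ := ihA α₁ h₁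
    refine ⟨α₂, h₂, fun β hβ => ?_⟩
    rw [← Matrix.mulVec_mulVec, e₁ β hβ, e₂ β hβ]

end TensorOp

/-! ### Operators that factor over the blocks of a partition. -/

section BlockOp

variable {V : Type*} [Fintype V]

/-- The tensor product of operators on the fibres of `block`. -/
def blockOp (block : V → V) (g : ∀ b : V, QOp {x // block x = b}) : QOp V :=
  Matrix.of fun x y => ∏ b, g b (fun s => x s) (fun s => y s)

theorem blockOp_apply (block : V → V) (g : ∀ b : V, QOp {x // block x = b}) (x y : V → Fin 2) :
    blockOp block g x y = ∏ b, g b (fun s => x s) (fun s => y s) := rfl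

theorem blockOp_conjTranspose (block : V → V) (g : ∀ b : V, QOp {x // block x = b}) :
    (blockOp block g)ᴴ = blockOp block fun b => (g b)ᴴ := by
  ext x y
  simp [blockOp_apply, Matrix.conjTranspose_apply]

variable [DecidableEq V]

/-- Configurations of all fibres of `block` are configurations of `V`. -/
def fibreEquiv (block : V → V) : (∀ b : V, {x // block x = b} → Fin 2) ≃ (V → Fin 2) where
  toFun w x := w (block x) ⟨x, rfl⟩
  invFun z _ s := z s
  left_inv w := by
    funext b ⟨s, hs⟩
    subst hs
    rfl
  right_inv _ := rfl

theorem blockOp_mul (block : V → V) (g h : ∀ b : V, QOp {x // block x = b}) :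
    blockOp block g * blockOp block h = blockOp block fun b => g b * h b := by
  ext x y
  simp only [Matrix.mul_apply, blockOp_apply, Finset.prod_univ_sum, Fintype.piFinset_univ,
    ← Finset.prod_mul_distrib]
  exact (Equiv.sum_comp (fibreEquiv block).symm fun w : ∀ b : V, {x // block x = b} → Fin 2 =>
    ∏ b, g b (fun s => x s) (w b) * h b (w b) (fun s => y s))

theorem tensorOp_eq_blockOp (block : V → V) (c : V → Matrix (Fin 2) (Fin 2) ℂ) :
    tensorOp c = blockOp block fun b => tensorOp fun s : {x // block x = b} => c s := by
  ext x y
  simp only [blockOp_apply, tensorOp_apply]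
  exact (Fintype.prod_fiberwise block fun k => c k (x k) (y k)).symm

theorem blockOp_one (block : V → V) : blockOp block (fun _ => 1) = 1 := by
  rw [← tensorOp_one, tensorOp_eq_blockOp block]
  simp only [tensorOp_one]

/-- Expanding the only nontrivial gate in matrix units gives a linear combination of tensor products
of single-qubit matrix units, each a product of operators on sites of `b₀`. -/
theorem blockOp_mem_localAlg (block : V → V) (b₀ : V) (h : ∀ b : V, QOp {x // block x = b})
    (h1 : ∀ b, b ≠ b₀ → h b = 1) : blockOp block h ∈ localAlg {x | block x = b₀} := by
  have key : blockOp block h = ∑ p, ∑ q, h b₀ p q • tensorOp fun k : V =>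
      if hk : block k = b₀ then Matrix.single (p ⟨k, hk⟩) (q ⟨k, hk⟩) (1 : ℂ) else 1 := by
    have e : ∀ p q : {x // block x = b₀} → Fin 2, ∀ b,
        (tensorOp fun s : {x // block x = b} => if hk : block s = b₀ then
          Matrix.single (p ⟨s, hk⟩) (q ⟨s, hk⟩) (1 : ℂ) else 1) =
        if hb : b = b₀ then hb ▸ Matrix.single p q (1 : ℂ) else 1 := by
      intro p q b
      split_ifs with hb
      · subst hb
        rw [← tensorOp_single]
        congr 1
        funext s
        rw [dif_pos s.2]
      · rw [← tensorOp_one]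
        congr 1
        funext s
        rw [dif_neg]
        rw [s.2]
        exact hb
    ext x y
    simp only [tensorOp_eq_blockOp block, e, Matrix.sum_apply, Matrix.smul_apply, blockOp_apply]
    simp only [← Finset.mul_prod_erase _ _ (Finset.mem_univ b₀)]
    have hr : ∀ g : ∀ b : V, QOp {x // block x = b}, (∀ b, b ≠ b₀ → g b = 1) →
        ∏ b ∈ Finset.univ.erase b₀, g b (fun s => x s) (fun s => y s) =
        ∏ b ∈ Finset.univ.erase b₀,
          (1 : QOp {x // block x = b}) (fun s => x s) (fun s => y s) := by
      intro g hg
      refine Finset.prod_congr rfl fun b hb => ?_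
      rw [hg b (Finset.ne_of_mem_erase hb)]
    rw [hr h h1]
    have hr' := fun p q => hr (fun b => if hb : b = b₀ then hb ▸ Matrix.single p q (1 : ℂ) else 1)
      (fun b hb => by simp [hb])
    simp only [hr', dite_true, smul_eq_mul, ← mul_assoc, ← Finset.sum_mul]
    congr 1
    simp [Matrix.single_apply, ite_and]
  rw [key]
  refine sum_mem fun p _ => sum_mem fun q _ => Subalgebra.smul_mem _ ?_ _
  refine tensorOp_induction (one_mem _) (fun A B hA hB => mul_mem hA hB) _ fun k => ?_
  split_ifs with hk
  · exact onSite_mem_localAlg (D := {x | block x = b₀}) hk _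
  · rw [onSite_one]
    exact one_mem _

end BlockOp

/-! ### Layers, Heisenberg evolution and backward light cones. -/

theorem tensorOp_update_fibre {V : Type*} [Fintype V] [DecidableEq V] {block : V → V} {b k : V}
    (hb : b ≠ block k) (a : Matrix (Fin 2) (Fin 2) ℂ) :
    (tensorOp fun s : {x // block x = b} =>
      Function.update (fun _ => 1 : V → Matrix (Fin 2) (Fin 2) ℂ) k a s) = 1 := by
  rw [← tensorOp_one]
  congr 1
  funext s
  rw [Function.update_of_ne]
  rintro rfl
  exact hb s.2.symm

namespace Layer

variable {V : Type*} [Fintype V] [DecidableEq V] {G : SimpleGraph V} {v : ℕ}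

theorem op_eq_blockOp (l : Layer G v) : l.op = blockOp l.block l.gate := rfl

theorem op_conjTranspose_mul (l : Layer G v) : l.opᴴ * l.op = 1 := by
  rw [op_eq_blockOp, blockOp_conjTranspose, blockOp_mul, ← blockOp_one l.block]
  congr 1
  funext b
  exact Matrix.mem_unitaryGroup_iff'.1 (l.gate_unitary b)

theorem op_mul_conjTranspose (l : Layer G v) : l.op * l.opᴴ = 1 := by
  rw [op_eq_blockOp, blockOp_conjTranspose, blockOp_mul, ← blockOp_one l.block]
  congr 1
  funext b
  exact Matrix.mem_unitaryGroup_iff.1 (l.gate_unitary b)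

theorem op_commute_of_idle {l : Layer G v} {j : V} (h : l.Idle j)
    (a : Matrix (Fin 2) (Fin 2) ℂ) : Commute l.op (onSite j a) := by
  rw [commute_iff_eq, op_eq_blockOp, onSite, tensorOp_eq_blockOp l.block, blockOp_mul, blockOp_mul]
  congr 1
  funext b
  by_cases hb : b = l.block j
  · subst hb
    rw [h.2, one_mul, mul_one]
  · rw [tensorOp_update_fibre hb, mul_one, one_mul]

/-- For a single-site operator, every gate off its block cancels against its adjoint. Conjugation by
a unitary is multiplicative, which extends this to the generated algebra. -/
theorem conj_mem_localAlg (l : Layer G v) {D : Set V} {A : QOp V} (hA : A ∈ localAlg D) :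
    l.opᴴ * A * l.op ∈ localAlg {x | ∃ y ∈ D, l.block x = l.block y} := by
  induction hA using Algebra.adjoin_induction with
  | mem A h =>
    obtain ⟨k, hk, a, rfl⟩ := h
    rw [op_eq_blockOp, onSite, tensorOp_eq_blockOp l.block, blockOp_conjTranspose, blockOp_mul,
      blockOp_mul]
    refine localAlg_mono ?_ (blockOp_mem_localAlg l.block (l.block k) _ fun b hb => ?_)
    · exact fun x hx => ⟨k, hk, hx⟩
    · rw [tensorOp_update_fibre hb, mul_one]
      exact Matrix.mem_unitaryGroup_iff'.1 (l.gate_unitary b)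
  | algebraMap r =>
    rw [Algebra.algebraMap_eq_smul_one, mul_smul_comm, mul_one, smul_mul_assoc,
      op_conjTranspose_mul]
    exact Subalgebra.smul_mem _ (one_mem _) _
  | add A B _ _ ihA ihB =>
    rw [mul_add, add_mul]
    exact add_mem ihA ihB
  | mul A B _ _ ihA ihB =>
    convert mul_mem ihA ihB using 1
    calc l.opᴴ * (A * B) * l.op = l.opᴴ * A * 1 * B * l.op := by noncomm_ring
      _ = _ := by rw [← l.op_mul_conjTranspose]; noncomm_ring

end Layer

namespace Protocol

variable {V : Type*} [Fintype V] [DecidableEq V] {G : SimpleGraph V} {v T N : ℕ}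

/-- `P.Reach t x y`: in the first `t` layers, there is a path of gates from the site `x` to the
site `y`. -/
def Reach (P : Protocol G v T N) : ℕ → V → V → Prop
  | 0, x, y => x = y
  | t + 1, x, y => ∃ z, P.Reach t x z ∧ ∀ h : t < T, (P.layer ⟨t, h⟩).block z =
      (P.layer ⟨t, h⟩).block y

/-- The backward light cone of `y`. -/
def cone (P : Protocol G v T N) (y : V) : Set V := {x | P.Reach T x y}

/-- The product of the first `t` layers. -/
def upTo (P : Protocol G v T N) (t : ℕ) : QOp V :=
  ((List.ofFn fun s => (P.layer s).op).take t).reverse.prod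

theorem upTo_zero (P : Protocol G v T N) : P.upTo 0 = 1 := by simp [upTo]

theorem upTo_succ (P : Protocol G v T N) {t : ℕ} (h : t < T) :
    P.upTo (t + 1) = (P.layer ⟨t, h⟩).op * P.upTo t := by
  rw [upTo, List.take_succ_eq_append_getElem (by simpa using h)]
  simp [upTo]

theorem circuit_eq_upTo (P : Protocol G v T N) : P.circuit = P.upTo T := by
  rw [circuit, after, upTo, List.drop_zero, List.take_of_length_le (by simp)]

theorem upTo_conjTranspose_mul (P : Protocol G v T N) (t : ℕ) (h : t ≤ T) :
    (P.upTo t)ᴴ * P.upTo t = 1 := by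
  induction t with
  | zero => simp [upTo_zero]
  | succ t ih =>
    rw [P.upTo_succ h, Matrix.conjTranspose_mul, mul_assoc, ← mul_assoc _ _ (P.upTo t),
      Layer.op_conjTranspose_mul, one_mul, ih (Nat.le_of_succ_le h)]

theorem circuit_conjTranspose_mul (P : Protocol G v T N) : P.circuitᴴ * P.circuit = 1 := by
  rw [circuit_eq_upTo]
  exact P.upTo_conjTranspose_mul T le_rfl

theorem circuit_mul_conjTranspose (P : Protocol G v T N) : P.circuit * P.circuitᴴ = 1 :=
  mul_eq_one_comm.1 P.circuit_conjTranspose_mul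

theorem upTo_conj_mem_localAlg (P : Protocol G v T N) (t : ℕ) (h : t ≤ T) {D : Set V} {A : QOp V}
    (hA : A ∈ localAlg D) :
    (P.upTo t)ᴴ * A * P.upTo t ∈ localAlg {x | ∃ y ∈ D, P.Reach t x y} := by
  induction t generalizing D A with
  | zero => simpa [upTo_zero, Reach] using hA
  | succ t ih =>
    have := ih (Nat.le_of_succ_le h) ((P.layer ⟨t, h⟩).conj_mem_localAlg hA)
    rw [P.upTo_succ h, Matrix.conjTranspose_mul]
    simp only [mul_assoc] at this ⊢
    refine localAlg_mono ?_ this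
    rintro x ⟨z, ⟨y, hy, e⟩, hz⟩
    exact ⟨y, hy, z, hz, fun _ => e⟩

/-- The Heisenberg evolution of a single-site operator is supported in the backward light cone. -/
theorem circuit_conj_onSite_mem (P : Protocol G v T N) (k : V) (a : Matrix (Fin 2) (Fin 2) ℂ) :
    P.circuitᴴ * onSite k a * P.circuit ∈ localAlg (P.cone k) := by
  have := P.upTo_conj_mem_localAlg T le_rfl (onSite_mem_localAlg (Set.mem_singleton k) a)
  rw [circuit_eq_upTo]
  refine localAlg_mono ?_ this
  rintro x ⟨y, rfl, h⟩
  exact h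

/-- Factors `±1` are scalars and need no cone condition. This is what lets one measured site be
ignored in the separation argument. -/
theorem circuit_conj_tensorOp_mem (P : Protocol G v T N) {D : Set V}
    (c : V → Matrix (Fin 2) (Fin 2) ℂ) (h : ∀ k, P.cone k ⊆ D ∨ c k = 1 ∨ c k = -1) :
    P.circuitᴴ * tensorOp c * P.circuit ∈ localAlg D := by
  refine tensorOp_induction (p := fun A => P.circuitᴴ * A * P.circuit ∈ localAlg D) ?_ ?_ c ?_
  · rw [mul_one, circuit_conjTranspose_mul]
    exact one_mem _
  · intro A B hA hB
    convert mul_mem hA hB using 1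
    calc P.circuitᴴ * (A * B) * P.circuit = P.circuitᴴ * A * 1 * B * P.circuit := by noncomm_ring
      _ = _ := by rw [← P.circuit_mul_conjTranspose]; noncomm_ring
  · intro k
    rcases h k with h | h | h
    · exact localAlg_mono h (P.circuit_conj_onSite_mem k _)
    · rw [h, onSite_one, mul_one, circuit_conjTranspose_mul]
      exact one_mem _
    · rw [h, onSite_neg, onSite_one, mul_neg, mul_one, neg_mul, circuit_conjTranspose_mul]
      exact neg_mem (one_mem _)

theorem after_mul_conjTranspose (P : Protocol G v T N) (t : ℕ) :
    P.after t * (P.after t)ᴴ = 1 := by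
  have : ∀ l : List (QOp V), (∀ A ∈ l, A * Aᴴ = 1) → l.prod * l.prodᴴ = 1 := by
    intro l
    induction l with
    | nil => simp
    | cons A l ih =>
      intro h
      rw [List.prod_cons, Matrix.conjTranspose_mul, mul_assoc, ← mul_assoc l.prod,
        ih fun B hB => h B (List.mem_cons_of_mem _ hB), one_mul, h A List.mem_cons_self]
  refine this _ fun A hA => ?_
  obtain ⟨s, rfl⟩ := (List.mem_ofFn' _ _).1 (List.mem_of_mem_drop (List.mem_reverse.1 hA))
  exact Layer.op_mul_conjTranspose _

/-- If the measured sites are not touched after their measurement, the observables in canonical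
form are single-site operators. -/
theorem canonicalObs_eq (P : Protocol G v T N) (n : Fin N)
    (h : ∀ t : Fin T, P.time n ≤ t → (P.layer t).Idle (P.site n)) :
    P.canonicalObs n = onSite (P.site n) (P.obs n).inv := by
  have : Commute (P.after (P.time n)) (onSite (P.site n) (P.obs n).inv) := by
    refine Commute.list_prod_left _ _ fun A hA => ?_
    obtain ⟨s, hs, rfl⟩ := List.mem_drop_iff_getElem.1 (List.mem_reverse.1 hA)
    rw [List.getElem_ofFn]
    exact Layer.op_commute_of_idle (h _ (Nat.le_add_right _ _)) _
  rw [canonicalObs, this.eq, mul_assoc, after_mul_conjTranspose, mul_one]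

end Protocol

/-! ### Pauli algebra and recovery operations. -/

theorem pauli_mul_self (a : Fin 4) : pauli a * pauli a = 1 := by
  fin_cases a <;> simp [pauli, Matrix.one_fin_two]

theorem pauli_commute_or (a b : Fin 4) :
    pauli a * pauli b = pauli b * pauli a ∨ pauli a * pauli b = -(pauli b * pauli a) := by
  fin_cases a <;> fin_cases b <;> simp [pauli]

theorem onSite_mul_tensorOp_commute_or {ι : Type*} [Fintype ι] [DecidableEq ι] (f : ι) (a : Fin 4)
    (χ : ι → Fin 4) :
    onSite f (pauli a) * tensorOp (fun x => pauli (χ x)) =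
        tensorOp (fun x => pauli (χ x)) * onSite f (pauli a) ∨
      onSite f (pauli a) * tensorOp (fun x => pauli (χ x)) =
        -(tensorOp (fun x => pauli (χ x)) * onSite f (pauli a)) := by
  have key : tensorOp (fun x => pauli (χ x)) =
      onSite f (pauli (χ f)) * tensorOp (Function.update (fun x => pauli (χ x)) f 1) := by
    rw [onSite, tensorOp_mul]
    congr 1
    funext j
    by_cases h : j = f
    · subst h; simp
    · simp [h]
  have hc : Commute (onSite f (pauli a))
      (tensorOp (Function.update (fun x => pauli (χ x)) f 1)) := by
    refine tensorOp_commute fun j => ?_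
    by_cases h : j = f
    · subst h; simp
    · simp [h]
  rw [key, ← mul_assoc, onSite_mul, mul_assoc _ _ (onSite f (pauli a)), ← hc.eq, ← mul_assoc,
    onSite_mul]
  rcases pauli_commute_or a (χ f) with h | h
  · exact Or.inl (by rw [h])
  · exact Or.inr (by rw [h, onSite_neg, neg_mul])

theorem kronecker_mulVec {m n : Type*} [Fintype m] [Fintype n]
    (A : Matrix m m ℂ) (B : Matrix n n ℂ) (Ψ : m × n → ℂ) (z : m × n) :
    ((A ⊗ₖ B) *ᵥ Ψ) z = ∑ s, B z.2 s * (A *ᵥ fun y => Ψ (y, s)) z.1 := by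
  obtain ⟨x, y⟩ := z
  simp only [Matrix.mulVec, dotProduct, Matrix.kroneckerMap_apply, Fintype.sum_prod_type,
    Finset.mul_sum]
  rw [Finset.sum_comm]
  exact Finset.sum_congr rfl fun _ _ => Finset.sum_congr rfl fun _ _ => by ring

namespace Protocol

variable {V : Type*} [Fintype V] [DecidableEq V] {G : SimpleGraph V} {v T N : ℕ}

theorem ssParity_mul_self (Ω : Finset (Fin N)) : ssParity Ω * ssParity Ω = 1 := by
  rw [ssParity, tensorOp_mul, ← tensorOp_one]
  congr 1
  funext n
  split_ifs
  · exact pauli_mul_self 3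
  · exact mul_one 1

theorem ssParity_commute (Ω : Finset (Fin N)) {d : Fin N → Matrix (Fin 2) (Fin 2) ℂ}
    (hd : ∀ n, d n = 1 ∨ d n = pauli 3) : Commute (ssParity Ω) (tensorOp d) := by
  refine tensorOp_commute fun n => ?_
  rcases hd n with h | h <;> rw [h] <;> split_ifs <;> simp

theorem recoveryOp_mul_self (r : Finset (Fin N) × (V → Fin 4)) :
    recoveryOp r * recoveryOp r = 1 := by
  have hχ : (tensorOp fun x => pauli (r.2 x)) * (tensorOp fun x => pauli (r.2 x)) = 1 := by
    simp only [tensorOp_mul, pauli_mul_self, tensorOp_one]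
  have h := ssParity_mul_self r.1
  simp only [recoveryOp, mul_add, add_mul, ← Matrix.mul_kronecker_mul, one_mul, mul_one, hχ]
  set S := ssParity r.1
  have h1 : ((2⁻¹ : ℂ) • (1 + S)) * ((2⁻¹ : ℂ) • (1 + S)) = (2⁻¹ : ℂ) • (1 + S) := by
    simp only [smul_mul_smul_comm, mul_add, add_mul, one_mul, mul_one, h]
    module
  have h2 : ((2⁻¹ : ℂ) • (1 - S)) * ((2⁻¹ : ℂ) • (1 - S)) = (2⁻¹ : ℂ) • (1 - S) := by
    simp only [smul_mul_smul_comm, mul_sub, sub_mul, one_mul, mul_one, h]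
    module
  have h3 : ((2⁻¹ : ℂ) • (1 - S)) * ((2⁻¹ : ℂ) • (1 + S)) = 0 := by
    simp only [smul_mul_smul_comm, mul_add, sub_mul, one_mul, mul_one, h]
    module
  have h4 : ((2⁻¹ : ℂ) • (1 + S)) * ((2⁻¹ : ℂ) • (1 - S)) = 0 := by
    simp only [smul_mul_smul_comm, mul_sub, add_mul, one_mul, mul_one, h]
    module
  rw [h1, h2, h3, h4, Matrix.kronecker_zero, add_zero, zero_add, ← Matrix.kronecker_add,
    ← Matrix.one_kronecker_one]
  congr 1
  module

theorem exists_mul_recovery_eq_one (l : List (Finset (Fin N) × (V → Fin 4))) :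
    ∃ R', R' * (l.map recoveryOp).prod = 1 := by
  induction l with
  | nil => exact ⟨1, by simp⟩
  | cons r l ih =>
    obtain ⟨R', h⟩ := ih
    refine ⟨R' * recoveryOp r, ?_⟩
    rw [List.map_cons, List.prod_cons, mul_assoc, ← mul_assoc (recoveryOp r),
      recoveryOp_mul_self, one_mul, h]

theorem recoveryOp_commute (r : Finset (Fin N) × (V → Fin 4))
    {d : Fin N → Matrix (Fin 2) (Fin 2) ℂ} (hd : ∀ n, d n = 1 ∨ d n = pauli 3) :
    Commute (recoveryOp r) ((1 : QOp V) ⊗ₖ tensorOp d) := by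
  have h := (ssParity_commute r.1 hd).eq
  rw [commute_iff_eq]
  simp only [recoveryOp, mul_add, add_mul, ← Matrix.mul_kronecker_mul, one_mul, mul_one,
    smul_mul_assoc, mul_smul_comm, sub_mul, mul_sub, h]

/-- If the string anticommutes with the Pauli operator on `f`, the exchange changes the sign of the
odd-parity term only. The parity operator `ssParity r.1` supplies exactly this sign. If they
commute, nothing changes. -/
theorem exists_onSite_mul_recoveryOp (r : Finset (Fin N) × (V → Fin 4)) (f : V) (a : Fin 4) :
    ∃ d : Fin N → Matrix (Fin 2) (Fin 2) ℂ, (∀ n, d n = 1 ∨ d n = pauli 3) ∧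
      (onSite f (pauli a) ⊗ₖ 1) * recoveryOp r =
        recoveryOp r * (onSite f (pauli a) ⊗ₖ tensorOp d) := by
  rcases onSite_mul_tensorOp_commute_or f a r.2 with h | h
  · refine ⟨fun _ => 1, fun _ => Or.inl rfl, ?_⟩
    rw [tensorOp_one]
    simp only [recoveryOp, mul_add, add_mul, ← Matrix.mul_kronecker_mul, one_mul, mul_one, h]
  · refine ⟨fun n => if n ∈ r.1 then pauli 3 else 1, fun n => by dsimp only; split_ifs <;> simp, ?_⟩
    change _ = recoveryOp r * (_ ⊗ₖ ssParity r.1)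
    have hS := ssParity_mul_self r.1
    simp only [recoveryOp, mul_add, add_mul, ← Matrix.mul_kronecker_mul, one_mul, mul_one, h]
    set S := ssParity r.1
    have h1 : ((2⁻¹ : ℂ) • (1 + S)) * S = (2⁻¹ : ℂ) • (1 + S) := by
      rw [smul_mul_assoc, add_mul, hS, one_mul, add_comm]
    have h2 : ((2⁻¹ : ℂ) • (1 - S)) * S = -((2⁻¹ : ℂ) • (1 - S)) := by
      rw [smul_mul_assoc, sub_mul, hS, one_mul, ← smul_neg, neg_sub]
    rw [h1, h2]
    congr 1
    ext z w
    simp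

theorem exists_onSite_mul_recovery (l : List (Finset (Fin N) × (V → Fin 4))) (f : V) (a : Fin 4) :
    ∃ d : Fin N → Matrix (Fin 2) (Fin 2) ℂ, (∀ n, d n = 1 ∨ d n = pauli 3) ∧
      (onSite f (pauli a) ⊗ₖ 1) * (l.map recoveryOp).prod =
        (l.map recoveryOp).prod * (onSite f (pauli a) ⊗ₖ tensorOp d) := by
  induction l with
  | nil => exact ⟨fun _ => 1, fun _ => Or.inl rfl, by simp [tensorOp_one]⟩
  | cons r l ih =>
    obtain ⟨d, hd, e⟩ := ih
    obtain ⟨d', hd', e'⟩ := exists_onSite_mul_recoveryOp r f a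
    refine ⟨fun n => d n * d' n, fun n => ?_, ?_⟩
    · have := pauli_mul_self 3
      rcases hd n with h | h <;> rcases hd' n with h' | h' <;> simp [h, h', this]
    · have hc : Commute (l.map recoveryOp).prod ((1 : QOp V) ⊗ₖ tensorOp d') := by
        refine Commute.list_prod_left _ _ fun A hA => ?_
        obtain ⟨s, -, rfl⟩ := List.mem_map.1 hA
        exact recoveryOp_commute s hd'
      have hs : onSite f (pauli a) ⊗ₖ tensorOp d' =
          (onSite f (pauli a) ⊗ₖ (1 : QOp (Fin N))) * ((1 : QOp V) ⊗ₖ tensorOp d') := by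
        rw [← Matrix.mul_kronecker_mul, mul_one, one_mul]
      rw [List.map_cons, List.prod_cons, ← mul_assoc, e', hs, mul_assoc, mul_assoc, ← hc.eq,
        ← mul_assoc (_ ⊗ₖ _), e, mul_assoc, mul_assoc, ← Matrix.mul_kronecker_mul, mul_one,
        tensorOp_mul]

end Protocol

/-! ### Measurement outcomes and branches. -/

/-- The eigenprojectors of a single-qubit observable. -/
def QubitObservable.proj (A : QubitObservable) (b : Fin 2) : Matrix (Fin 2) (Fin 2) ℂ :=
  if b = 0 then (2⁻¹ : ℂ) • (1 + A.inv) else (2⁻¹ : ℂ) • (1 - A.inv)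

namespace Protocol

variable {V : Type*} [Fintype V] [DecidableEq V] {G : SimpleGraph V} {v T N : ℕ}

theorem onSite_pauli_one_apply (n : Fin N) (s s' : Fin N → Fin 2) :
    onSite n (pauli 1) s s' = if s' = Function.update s n (s n + 1) then 1 else 0 := by
  have : onSite n (pauli 1) s s' = (onSite n (pauli 1) *ᵥ Pi.single s' 1) s := by simp
  have hp : ∀ b c : Fin 2, pauli 1 b c = if c = b + 1 then 1 else 0 := by
    intro b c
    fin_cases b <;> fin_cases c <;> simp [pauli]
  rw [this, onSite_mulVec]
  simp only [hp, ite_mul, one_mul, zero_mul, Finset.sum_ite_eq', Finset.mem_univ, if_true,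
    Pi.single_apply, eq_comm]

/-- The unnormalized state `χ` after the measurements in `l` (the first one last) with
outcomes `s`. -/
def branch (P : Protocol G v T N) (l : List (Fin N)) (s : Fin N → Fin 2) : QOp V :=
  (l.map fun n => onSite (P.site n) ((P.obs n).proj (s n))).prod

/-- Each Stinespring qubit is written only once and starts in `0`, so its final value labels the
eigenprojector applied. Qubits of measurements outside `l` remain `0`. -/
theorem measure_list_mulVec (P : Protocol G v T N)
    (hP : ∀ n, P.canonicalObs n = onSite (P.site n) (P.obs n).inv) (χ : (V → Fin 2) → ℂ)
    (l : List (Fin N)) (hl : l.Nodup) :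
    (l.map P.measure).prod *ᵥ (fun z => χ z.1 * if z.2 = 0 then 1 else 0) =
      fun z => if ∀ n ∉ l, z.2 n = 0 then (P.branch l z.2 *ᵥ χ) z.1 else 0 := by
  induction l with
  | nil =>
    funext z
    simp [branch, funext_iff]
  | cons n l ih =>
    have hn : n ∉ l := (List.nodup_cons.1 hl).1
    rw [List.map_cons, List.prod_cons, ← Matrix.mulVec_mulVec, ih (List.nodup_cons.1 hl).2]
    have e0 : (2⁻¹ : ℂ) • (1 + P.canonicalObs n) =
        onSite (P.site n) ((P.obs n).proj 0) := by
      rw [hP, QubitObservable.proj, if_pos rfl, onSite_smul, onSite_add, onSite_one]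
    have e1 : (2⁻¹ : ℂ) • (1 - P.canonicalObs n) =
        onSite (P.site n) ((P.obs n).proj 1) := by
      rw [hP, QubitObservable.proj, if_neg one_ne_zero, onSite_smul, sub_eq_add_neg, sub_eq_add_neg,
        onSite_add, onSite_one, onSite_neg]
    funext ⟨x, s⟩
    have hb : ∀ b, P.branch l (Function.update s n b) = P.branch l s := by
      intro b
      unfold branch
      congr 1
      refine List.map_congr_left fun m hm => ?_
      rw [Function.update_of_ne]
      rintro rfl
      exact hn hm
    have hz : ∀ A : QOp V, (A *ᵥ fun _ => 0) = 0 := fun A => Matrix.mulVec_zero A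
    rw [measure, e0, e1, Matrix.add_mulVec, Pi.add_apply, kronecker_mulVec, kronecker_mulVec]
    simp only [onSite_pauli_one_apply, Matrix.one_apply, ite_mul, one_mul, zero_mul,
      Finset.sum_ite_eq, Finset.sum_ite_eq', Finset.mem_univ, if_true]
    have hc : (∀ m ∉ n :: l, s m = 0) ↔ ∀ m ∉ l, Function.update s n 0 m = 0 := by
      simp only [List.mem_cons, not_or]
      constructor
      · intro h m hm
        by_cases e : m = n
        · subst e; simp
        · simpa [e] using h m ⟨e, hm⟩
      · intro h m hm
        simpa [hm.1] using h m hm.2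
    have hs : s n = 0 ∨ s n = 1 := by
      generalize s n = b; fin_cases b <;> simp
    -- Qubit `n` was `0` before this measurement, so only the term without flip contributes to `s n
    -- = 0`, and only the flipped term to `s n = 1`.
    rcases hs with h0 | h1
    · have : Function.update s n 0 = s := by rw [← h0, Function.update_eq_self]
      rw [this] at hc
      have hno : ¬ ∀ m ∉ l, Function.update s n (s n + 1) m = 0 := fun h => by
        simpa [h0] using h n hn
      simp only [hno, hc, if_false, hz, Pi.zero_apply, add_zero]
      split_ifs
      · rw [Matrix.mulVec_mulVec, branch, branch, List.map_cons, List.prod_cons, h0]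
      · simp [hz]
    · have hno : ¬ ∀ m ∉ l, s m = 0 := fun h => by simpa [h1] using h n hn
      have h11 : s n + 1 = 0 := by rw [h1]; rfl
      simp only [hno, hc, h11, if_false, hz, Pi.zero_apply, zero_add, hb]
      split_ifs
      · rw [Matrix.mulVec_mulVec, branch, branch, List.map_cons, List.prod_cons, h1]
      · simp [hz]

end Protocol

section TensorOp

variable {ι : Type*} [Fintype ι] [DecidableEq ι]

theorem sum_tensorOp (g : ι → Fin 2 → Matrix (Fin 2) (Fin 2) ℂ) :
    ∑ u : ι → Fin 2, tensorOp (fun j => g j (u j)) = tensorOp fun j => ∑ b, g j b := by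
  ext x y
  simp only [Matrix.sum_apply, tensorOp_apply, Finset.prod_univ_sum, Fintype.piFinset_univ]

theorem prodState_update (φ : ι → Fin 2 → ℂ) (i : ι) (ψ : Fin 2 → ℂ) (x : ι → Fin 2) :
    prodState (Function.update φ i ψ) x = ψ (x i) * ∏ k ∈ Finset.univ.erase i, φ k (x k) := by
  rw [prodState, ← Finset.mul_prod_erase _ _ (Finset.mem_univ i), Function.update_self]
  congr 1
  refine Finset.prod_congr rfl fun j hj => ?_
  rw [Function.update_of_ne (Finset.ne_of_mem_erase hj)]

theorem prodState_update_smul (φ : ι → Fin 2 → ℂ) (i : ι) (c : ℂ) (ψ : Fin 2 → ℂ) :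
    prodState (Function.update φ i (c • ψ)) = c • prodState (Function.update φ i ψ) := by
  funext x
  simp only [prodState_update, Pi.smul_apply, smul_eq_mul, mul_assoc]

end TensorOp

theorem pauli_three_apply_ne {b c : Fin 2} (h : b ≠ c) : pauli 3 b c = 0 := by
  fin_cases b <;> fin_cases c <;> first | exact absurd rfl h | simp [pauli]

theorem exists_eq_vecMulVec {M : Matrix (Fin 2) (Fin 2) ℂ} (h : M.det = 0) :
    ∃ α β, M = Matrix.vecMulVec α β := by
  rw [Matrix.det_fin_two] at h
  by_cases h0 : M 0 0 = 0
  · by_cases h1 : M 0 1 = 0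
    · refine ⟨![0, 1], M 1, ?_⟩
      ext b c
      fin_cases b <;> fin_cases c <;> simp [Matrix.vecMulVec_apply, h0, h1]
    · refine ⟨![1, M 1 1 / M 0 1], M 0, ?_⟩
      ext b c
      fin_cases b <;> fin_cases c <;> simp [Matrix.vecMulVec_apply, h0]
      · have : M 0 1 * M 1 0 = 0 := by linear_combination -h + M 1 1 * h0
        exact (mul_eq_zero.1 this).resolve_left h1
      · field_simp
  · refine ⟨![1, M 1 0 / M 0 0], M 0, ?_⟩
    ext b c
    fin_cases b <;> fin_cases c <;> simp [Matrix.vecMulVec_apply]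
    · field_simp
    · field_simp
      linear_combination h

/-! ### Eigenprojectors of nontrivial single-qubit observables. -/

namespace QubitObservable

variable (A : QubitObservable)

theorem inv_sub_one : A.inv - 1 = (2 * ((A.hi : ℂ) - A.lo)⁻¹) • (A.mat - (A.hi : ℂ) • 1) := by
  have h : (A.hi : ℂ) - A.lo ≠ 0 := sub_ne_zero.2 fun h => A.lo_lt_hi.ne' (Complex.ofReal_injective h)
  ext b c
  simp only [inv, Matrix.sub_apply, Matrix.smul_apply, smul_eq_mul]
  field_simp
  ring

theorem inv_add_one : A.inv + 1 = (2 * ((A.hi : ℂ) - A.lo)⁻¹) • (A.mat - (A.lo : ℂ) • 1) := by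
  have h : (A.hi : ℂ) - A.lo ≠ 0 := sub_ne_zero.2 fun h => A.lo_lt_hi.ne' (Complex.ofReal_injective h)
  ext b c
  simp only [inv, Matrix.sub_apply, Matrix.add_apply, Matrix.smul_apply, smul_eq_mul]
  field_simp
  ring

theorem inv_sub_one_mul : (A.inv - 1) * (A.inv + 1) = 0 := by
  rw [inv_sub_one, inv_add_one, smul_mul_smul_comm, A.annihilate, smul_zero]

theorem inv_mul_self : A.inv * A.inv = 1 := by
  have h := A.inv_sub_one_mul
  rw [sub_mul, mul_add, mul_one, one_mul] at h
  rw [← sub_eq_zero, ← h]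
  abel

theorem two_mul_inv_ne_zero : 2 * ((A.hi : ℂ) - A.lo)⁻¹ ≠ 0 :=
  mul_ne_zero two_ne_zero
    (inv_ne_zero (sub_ne_zero.2 fun h => A.lo_lt_hi.ne' (Complex.ofReal_injective h)))

theorem inv_sub_one_ne_zero : A.inv - 1 ≠ 0 := by
  rw [inv_sub_one]
  exact smul_ne_zero A.two_mul_inv_ne_zero (sub_ne_zero.2 A.ne_hi)

theorem inv_add_one_ne_zero : A.inv + 1 ≠ 0 := by
  rw [inv_add_one]
  exact smul_ne_zero A.two_mul_inv_ne_zero (sub_ne_zero.2 A.ne_lo)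

theorem det_proj (b : Fin 2) : (A.proj b).det = 0 := by
  have h1 : (A.inv - 1).det = 0 := by
    by_contra h
    have := (Matrix.isUnit_iff_isUnit_det _).2 (isUnit_iff_ne_zero.2 h)
    exact A.inv_add_one_ne_zero (this.mul_right_eq_zero.1 A.inv_sub_one_mul)
  have h2 : (A.inv + 1).det = 0 := by
    by_contra h
    have := (Matrix.isUnit_iff_isUnit_det _).2 (isUnit_iff_ne_zero.2 h)
    exact A.inv_sub_one_ne_zero (this.mul_left_eq_zero.1 A.inv_sub_one_mul)
  rw [proj]
  split_ifs
  · rw [Matrix.det_smul, add_comm, h2, mul_zero]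
  · rw [Matrix.det_smul, ← neg_sub, Matrix.det_neg, h1, mul_zero, mul_zero]

theorem proj_add : A.proj 0 + A.proj 1 = 1 := by
  rw [proj, proj, if_pos rfl, if_neg one_ne_zero]
  module

theorem proj_sub : A.proj 0 - A.proj 1 = A.inv := by
  rw [proj, proj, if_pos rfl, if_neg one_ne_zero]
  module

theorem proj_ne_zero (b : Fin 2) : A.proj b ≠ 0 := by
  rw [proj]
  split_ifs
  · rw [add_comm]
    exact smul_ne_zero (by norm_num) A.inv_add_one_ne_zero
  · rw [← neg_sub, smul_neg]
    exact neg_ne_zero.2 (smul_ne_zero (by norm_num) A.inv_sub_one_ne_zero)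

end QubitObservable

/-! ### Repeated measurements of one site. -/

namespace Protocol

variable {V : Type*} [Fintype V] [DecidableEq V] {G : SimpleGraph V} {v T N : ℕ}

/-- The action of the measurements in `l` with outcomes `s` on the site `j`. -/
def siteBranch (P : Protocol G v T N) (l : List (Fin N)) (s : Fin N → Fin 2) (j : V) :
    Matrix (Fin 2) (Fin 2) ℂ :=
  (l.map fun n => if P.site n = j then (P.obs n).proj (s n) else 1).prod

theorem siteBranch_congr (P : Protocol G v T N) (l : List (Fin N)) {s s' : Fin N → Fin 2} {j : V}
    (h : ∀ n ∈ l, P.site n = j → s n = s' n) : P.siteBranch l s j = P.siteBranch l s' j := by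
  unfold siteBranch
  congr 1
  refine List.map_congr_left fun n hn => ?_
  split_ifs with hj
  · rw [h n hn hj]
  · rfl

theorem branch_eq_tensorOp (P : Protocol G v T N) (l : List (Fin N)) (s : Fin N → Fin 2) :
    P.branch l s = tensorOp (P.siteBranch l s) := by
  induction l with
  | nil => exact tensorOp_one.symm
  | cons n l ih =>
    have : P.branch (n :: l) s = onSite (P.site n) ((P.obs n).proj (s n)) * P.branch l s := by
      simp [branch]
    rw [this, ih, onSite, tensorOp_mul]
    congr 1
    funext j
    by_cases h : j = P.site n
    · subst h; simp [siteBranch]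
    · simp [siteBranch, h, Ne.symm h]

theorem siteBranch_of_unmeasured (P : Protocol G v T N) (l : List (Fin N)) (s : Fin N → Fin 2)
    {j : V} (h : ∀ n ∈ l, P.site n ≠ j) : P.siteBranch l s j = 1 := by
  refine List.prod_eq_one fun A hA => ?_
  obtain ⟨n, hn, rfl⟩ := List.mem_map.1 hA
  rw [if_neg (h n hn)]

/-- After the first measurement of a site, some outcomes of the later measurements of that site
have a nonzero amplitude. -/
theorem exists_siteBranch_eq_vecMulVec (P : Protocol G v T N) (l : List (Fin N)) (hl : l.Nodup)
    (j : V) (h : ∃ n ∈ l, P.site n = j) :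
    ∃ (A : QubitObservable) (β : Fin 2 → Fin 2 → ℂ),
      (∀ u, ∃ α, A.proj u = Matrix.vecMulVec α (β u)) ∧
      ∀ u, ∃ s α, α ≠ 0 ∧ P.siteBranch l s j = Matrix.vecMulVec α (β u) := by
  induction l with
  | nil => simp at h
  | cons n l ih =>
    have hn : n ∉ l := (List.nodup_cons.1 hl).1
    have hcons : ∀ s, P.siteBranch (n :: l) s j =
        (if P.site n = j then (P.obs n).proj (s n) else 1) * P.siteBranch l s j := by
      intro s; simp [siteBranch]
    by_cases hm : ∃ m ∈ l, P.site m = j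
    · obtain ⟨A, β, hA, hβ⟩ := ih (List.nodup_cons.1 hl).2 hm
      refine ⟨A, β, hA, fun u => ?_⟩
      obtain ⟨s, α, hα, e⟩ := hβ u
      by_cases hj : P.site n = j
      -- The two projectors sum to `1`, so at least one outcome does not annihilate `α`. The row
      -- vector `β u`, fixed by the first measurement of the site, is unaffected.
      · obtain ⟨b, hb⟩ : ∃ b, (P.obs n).proj b *ᵥ α ≠ 0 := by
          by_contra! hb
          apply hα
          rw [← Matrix.one_mulVec α, ← (P.obs n).proj_add, Matrix.add_mulVec, hb, hb, add_zero]
        refine ⟨Function.update s n b, (P.obs n).proj b *ᵥ α, hb, ?_⟩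
        rw [hcons, if_pos hj, P.siteBranch_congr l (s' := s), e, Function.update_self,
          Matrix.mul_vecMulVec]
        intro m hm _
        rw [Function.update_of_ne]
        rintro rfl
        exact hn hm
      · exact ⟨s, α, hα, by rw [hcons, if_neg hj, one_mul, e]⟩
    · push Not at hm
      have hj : P.site n = j := by
        obtain ⟨m, hm', e⟩ := h
        rcases List.mem_cons.1 hm' with rfl | hm'
        · exact e
        · exact absurd e (hm m hm')
      choose α β e using fun b => exists_eq_vecMulVec ((P.obs n).det_proj b)
      refine ⟨P.obs n, β, fun u => ⟨α u, e u⟩, fun u => ⟨fun _ => u, α u, ?_, ?_⟩⟩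
      · intro h0
        apply (P.obs n).proj_ne_zero u
        rw [e, h0, Matrix.zero_vecMulVec]
      · rw [hcons, if_pos hj, P.siteBranch_of_unmeasured l _ hm, mul_one, e]

/-- The later measurements of a site can be undone for suitable outcomes. -/
theorem exists_mul_siteBranch (P : Protocol G v T N) (l : List (Fin N)) (hl : l.Nodup) (j : V) :
    ∃ (q w : Fin 2 → Matrix (Fin 2) (Fin 2) ℂ) (s : Fin 2 → Fin N → Fin 2),
      q 0 + q 1 = 1 ∧ (q 0 - q 1) * (q 0 - q 1) = 1 ∧
      (∀ u, w u * P.siteBranch l (s u) j = q u) ∧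
      ((∀ n ∈ l, P.site n ≠ j) → q 0 - q 1 = 1 ∧ ∀ u, ∃ c : ℂ, w u = c • 1) := by
  by_cases h : ∃ n ∈ l, P.site n = j
  · obtain ⟨A, β, hA, hβ⟩ := P.exists_siteBranch_eq_vecMulVec l hl j h
    choose α₀ h₀ using hA
    choose s α hα e using hβ
    have : ∀ u, ∃ γ : Fin 2 → ℂ, γ ⬝ᵥ α u = 1 := by
      intro u
      obtain ⟨b, hb⟩ := Function.ne_iff.1 (hα u)
      exact ⟨Pi.single b (α u b)⁻¹, by simpa using inv_mul_cancel₀ hb⟩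
    choose γ hγ using this
    -- `w u` replaces the column vector left by the later measurements by that of the first
    -- projector.
    refine ⟨A.proj, fun u => Matrix.vecMulVec (α₀ u) (γ u), s, A.proj_add, ?_, fun u => ?_, ?_⟩
    · rw [A.proj_sub, A.inv_mul_self]
    · rw [e, h₀, Matrix.vecMulVec_mul_vecMulVec, hγ, one_smul]
    · intro h'
      obtain ⟨n, hn, e⟩ := h
      exact absurd e (h' n hn)
  · push Not at h
    -- An unmeasured site gets the trivial resolution `1 + 0`, whose involution is `1`.
    refine ⟨![1, 0], ![1, 0], fun _ _ => 0, by simp, by simp, fun u => ?_, fun _ => ⟨by simp, ?_⟩⟩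
    · rw [P.siteBranch_of_unmeasured l _ h, mul_one]
    · intro u
      fin_cases u
      · exact ⟨1, by simp⟩
      · exact ⟨0, by simp⟩

/-- The physical state after the circuit, before the measurements. -/
def evolved (P : Protocol G v T N) (φ : V → Fin 2 → ℂ) (i : V) (ψ : Fin 2 → ℂ) :
    (V → Fin 2) → ℂ :=
  P.circuit *ᵥ prodState (Function.update φ i ψ)

theorem initial_smul (φ : V → Fin 2 → ℂ) (i : V) (c : ℂ) (ψ : Fin 2 → ℂ) :
    (initial φ i (c • ψ) : (V → Fin 2) × (Fin N → Fin 2) → ℂ) = c • initial φ i ψ := by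
  funext z
  simp only [initial, prodState_update_smul, Pi.smul_apply, smul_eq_mul, mul_assoc]

/-- Both sides are homogeneous of degree one in `ψ`, so the normalization can be dropped. -/
theorem Transfers.linear {P : Protocol G v T N} {φ : V → Fin 2 → ℂ} {i f : V}
    (h : P.Transfers φ i f) :
    ∃ Φ : ({x : V // x ≠ f} → Fin 2) → (Fin N → Fin 2) → ℂ, ∀ ψ : Fin 2 → ℂ,
      P.dilated *ᵥ initial φ i ψ = fun z => ψ (z.1 f) * Φ (fun x => z.1 x) z.2 := by
  obtain ⟨Φ, h⟩ := h
  refine ⟨Φ, fun ψ => ?_⟩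
  by_cases h0 : ψ = 0
  · have : (initial φ i ψ : (V → Fin 2) × (Fin N → Fin 2) → ℂ) = 0 := by
      funext z
      simp [initial, prodState_update, h0]
    rw [this, Matrix.mulVec_zero, h0]
    funext z
    simp
  · have hpos : 0 < ∑ b, ‖ψ b‖ ^ 2 := by
      obtain ⟨b, hb⟩ := Function.ne_iff.1 h0
      exact Finset.sum_pos' (fun _ _ => by positivity)
        ⟨b, Finset.mem_univ b, by have := norm_pos_iff.2 hb; positivity⟩
    set r := Real.sqrt (∑ b, ‖ψ b‖ ^ 2) with hr
    have hr0 : 0 < r := Real.sqrt_pos.2 hpos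
    have hrc : (r : ℂ) ≠ 0 := Complex.ofReal_ne_zero.2 hr0.ne'
    have hn : ∑ b, ‖((r : ℂ)⁻¹ • ψ) b‖ ^ 2 = 1 := by
      simp only [Pi.smul_apply, smul_eq_mul, norm_mul, mul_pow, ← Finset.mul_sum, norm_inv,
        Complex.norm_real, Real.norm_eq_abs, abs_of_pos hr0]
      rw [inv_pow, hr, Real.sq_sqrt hpos.le, inv_mul_cancel₀ hpos.ne']
    have := congrArg ((r : ℂ) • ·) (h _ hn)
    simp only [initial_smul, Matrix.mulVec_smul, smul_inv_smul₀ hrc] at this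
    rw [this]
    funext z
    simp only [Pi.smul_apply, smul_eq_mul]
    field_simp

/-! ### Logical Pauli operators on a measurement branch. -/

namespace IsStandardTeleportation

variable {P : Protocol G v T N} {φ : V → Fin 2 → ℂ} {i f : V}

theorem canonicalObs_eq (h : P.IsStandardTeleportation φ i f) (n : Fin N) :
    P.canonicalObs n = onSite (P.site n) (P.obs n).inv :=
  P.canonicalObs_eq n (h.untouched n)

/-- On every branch, a Pauli operator on `f` acts as that Pauli operator on the logical state, up
to a sign that is a product of signs of the outcomes. -/
theorem exists_sign (h : P.IsStandardTeleportation φ i f) (a : Fin 4) :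
    ∃ d : Fin N → Fin 2 → ℂ, (∀ n b, d n b = 1 ∨ d n b = -1) ∧ ∀ s ψ,
      (∏ n, d n (s n)) • (onSite f (pauli a) *ᵥ
        (tensorOp (P.siteBranch (List.finRange N).reverse s) *ᵥ P.evolved φ i ψ)) =
      tensorOp (P.siteBranch (List.finRange N).reverse s) *ᵥ P.evolved φ i (pauli a *ᵥ ψ) := by
  obtain ⟨Φ, hΦ⟩ := h.transfers.linear
  obtain ⟨d, hd, hR⟩ := exists_onSite_mul_recovery P.recovery f a
  obtain ⟨R', hR'⟩ := exists_mul_recovery_eq_one P.recovery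
  refine ⟨fun n b => d n b b, fun n b => ?_, fun s ψ => ?_⟩
  · dsimp only
    rcases hd n with e | e <;> rw [e] <;> fin_cases b <;> simp [pauli]
  have hM : ∀ ψ, ((List.ofFn P.measure).reverse.prod * (P.circuit ⊗ₖ (1 : QOp (Fin N)))) *ᵥ
      initial φ i ψ = fun z =>
        (tensorOp (P.siteBranch (List.finRange N).reverse z.2) *ᵥ P.evolved φ i ψ) z.1 := by
    intro ψ
    have h1 : (P.circuit ⊗ₖ (1 : QOp (Fin N))) *ᵥ initial φ i ψ =
        fun z => P.evolved φ i ψ z.1 * if z.2 = 0 then 1 else 0 := by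
      funext z
      rw [kronecker_mulVec]
      simp only [Matrix.one_apply, ite_mul, one_mul, zero_mul, Finset.sum_ite_eq, Finset.mem_univ,
        if_true, initial, evolved]
      split_ifs with hz
      · simp
      · simp [Matrix.mulVec, dotProduct]
    rw [← Matrix.mulVec_mulVec, h1, List.ofFn_eq_map, ← List.map_reverse,
      P.measure_list_mulVec h.canonicalObs_eq _ _ (List.nodup_reverse.2 (List.nodup_finRange N))]
    funext z
    rw [if_pos (by simp), branch_eq_tensorOp]
  have hX : (onSite f (pauli a) ⊗ₖ (1 : QOp (Fin N))) *ᵥ (P.dilated *ᵥ initial φ i ψ) =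
      P.dilated *ᵥ initial φ i (pauli a *ᵥ ψ) := by
    rw [hΦ, hΦ]
    funext z
    rw [kronecker_mulVec]
    simp only [Matrix.one_apply, ite_mul, one_mul, zero_mul, Finset.sum_ite_eq, Finset.mem_univ,
      if_true, onSite_mulVec, Function.update_self]
    rw [Matrix.mulVec, dotProduct, Finset.sum_mul]
    refine Finset.sum_congr rfl fun c _ => ?_
    rw [mul_assoc]
    congr 3
    funext x
    rw [Function.update_of_ne x.2]
  rw [dilated, Matrix.mulVec_mulVec, mul_assoc _ _ (P.circuit ⊗ₖ (1 : QOp (Fin N))), ← mul_assoc,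
    hR] at hX
  have hX := congrArg (R' *ᵥ ·) hX
  simp only [Matrix.mulVec_mulVec, ← mul_assoc, hR', one_mul] at hX
  rw [mul_assoc, ← Matrix.mulVec_mulVec, hM, hM] at hX
  have hs := congrFun hX
  funext x
  have hs := hs (x, s)
  rw [kronecker_mulVec] at hs
  -- The operator on the Stinespring qubits is diagonal, so it multiplies the branch `s` by its
  -- diagonal entry, a product of signs.
  rw [← hs, Finset.sum_eq_single s]
  · simp [tensorOp_apply]
  · intro s' _ hne
    rw [tensorOp_apply]
    obtain ⟨n, hn⟩ := Function.ne_iff.1 hne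
    rw [Finset.prod_eq_zero (Finset.mem_univ n), zero_mul]
    rcases hd n with e | e <;> rw [e]
    · simp [Ne.symm hn]
    · exact pauli_three_apply_ne (Ne.symm hn)
  · simp

theorem evolved_ne_zero (h : P.IsStandardTeleportation φ i f) {ψ : Fin 2 → ℂ} (hψ : ψ ≠ 0) :
    P.evolved φ i ψ ≠ 0 := by
  intro h0
  have h1 : prodState (Function.update φ i ψ) = 0 := by
    rw [← Matrix.one_mulVec (prodState _), ← P.circuit_conjTranspose_mul, ← Matrix.mulVec_mulVec]
    exact (congrArg _ h0).trans (Matrix.mulVec_zero _)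
  have : ∀ k, ∃ b, Function.update φ i ψ k b ≠ 0 := by
    intro k
    by_cases hk : k = i
    · subst hk
      simpa using Function.ne_iff.1 hψ
    · by_contra! hb
      have := h.normalized k hk
      simp [Function.update_of_ne hk] at hb
      simp [hb] at this
  choose x hx using this
  exact Finset.prod_ne_zero_iff.2 (fun k _ => hx k) (congrFun h1 x)

end IsStandardTeleportation

end Protocol

/-! ### Factorization of logical operators on product states. -/

/-- If an operator on `D` times an operator on the complement of `D` maps the logical state at
`i ∈ D` linearly, in a product with fixed states of the other qubits, then so does the operator on
`D` alone, up to scalar factors. -/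
theorem exists_smul_mulVec_prodState {ι : Type*} [Fintype ι] [DecidableEq ι] {D : Set ι}
    {A B : QOp ι} (hA : A ∈ localAlg D) (hB : B ∈ localAlg Dᶜ) {φ : ι → Fin 2 → ℂ} {i : ι}
    (hi : i ∈ D) (hφ : ∀ k, k ≠ i → φ k ≠ 0) (a : Matrix (Fin 2) (Fin 2) ℂ)
    (h : ∀ ψ, (A * B) *ᵥ prodState (Function.update φ i ψ) =
      prodState (Function.update φ i (a *ᵥ ψ))) :
    ∃ μ ν : ℂ, ν ≠ 0 ∧ ∀ ψ, μ • (A *ᵥ prodState (Function.update φ i ψ)) =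
      ν • prodState (Function.update φ i (a *ᵥ ψ)) := by
  classical
  set α : (Fin 2 → ℂ) → (ι → Fin 2) → ℂ := fun ψ x =>
    ∏ k, if k ∈ D then Function.update φ i ψ k (x k) else 1 with hαdef
  set β : (ι → Fin 2) → ℂ := fun x => ∏ k, if k ∈ D then 1 else φ k (x k) with hβdef
  have hα : ∀ ψ x y, (∀ k ∈ D, x k = y k) → α ψ x = α ψ y := by
    intro ψ x y hxy
    refine Finset.prod_congr rfl fun k _ => ?_
    split_ifs with hk
    · rw [hxy k hk]
    · rfl
  have hβ : ∀ x y, (∀ k ∉ D, x k = y k) → β x = β y := by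
    intro x y hxy
    refine Finset.prod_congr rfl fun k _ => ?_
    split_ifs with hk
    · rfl
    · rw [hxy k hk]
  have hχ : ∀ ψ, prodState (Function.update φ i ψ) = fun x => α ψ x * β x := by
    intro ψ
    funext x
    rw [prodState, hαdef, hβdef, ← Finset.prod_mul_distrib]
    refine Finset.prod_congr rfl fun k _ => ?_
    split_ifs with hk
    · rw [mul_one]
    · rw [Function.update_of_ne (ne_of_mem_of_not_mem hi hk).symm, one_mul]
  choose α' hα' eA using fun ψ => localAlg_mulVec_mul hA (α ψ) (hα ψ)
  obtain ⟨β', hβ', eB⟩ := localAlg_mulVec_mul hB β (fun x y hxy => hβ x y hxy)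
  have hβ'' : ∀ x y, (∀ k ∉ D, x k = y k) → β' x = β' y := fun x y hxy => hβ' x y hxy
  have key : ∀ ψ x, α' ψ x * β' x = α (a *ᵥ ψ) x * β x := by
    intro ψ x
    have h1 := h ψ
    have h2 := eB (α ψ) (fun x y hxy => hα ψ x y fun k hk => hxy k (by simpa using hk))
    rw [← Matrix.mulVec_mulVec, hχ, hχ] at h1
    simp only [mul_comm (α ψ _)] at h1
    rw [h2] at h1
    simp only [mul_comm (β' _)] at h1
    rw [eA ψ β' hβ''] at h1
    exact congrFun h1 x
  have hy : ∀ k, ∃ b, k ≠ i → φ k b ≠ 0 := by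
    intro k
    by_cases hk : k = i
    · exact ⟨0, fun h => absurd hk h⟩
    · obtain ⟨b, hb⟩ := Function.ne_iff.1 (hφ k hk)
      exact ⟨b, fun _ => hb⟩
  choose y hy using hy
  -- Freezing the qubits outside `D` at `y`, where the fixed state has nonzero amplitude, turns
  -- `key` into an identity of the factors on `D`.
  refine ⟨β' y, β y, ?_, fun ψ => ?_⟩
  · refine Finset.prod_ne_zero_iff.2 fun k _ => ?_
    split_ifs with hk
    · exact one_ne_zero
    · exact hy k fun e => hk (e ▸ hi)
  · rw [hχ, hχ, eA ψ β hβ]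
    funext x
    have hz := key ψ fun k => if k ∈ D then x k else y k
    rw [hα' ψ _ x fun k hk => if_pos hk, hα (a *ᵥ ψ) _ x fun k hk => if_pos hk,
      hβ'' _ y fun k hk => if_neg hk, hβ _ y fun k hk => if_neg hk] at hz
    simp only [Pi.smul_apply, smul_eq_mul]
    linear_combination β x * hz

/-! ### Logical operators before the measurements. -/

namespace Protocol

variable {V : Type*} [Fintype V] [DecidableEq V] {G : SimpleGraph V} {v T N : ℕ}

/-- The outcomes selected at a site depend on `u` at that site only. Hence the selected branches can
be completed, site by site, to a resolution of the identity. -/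
theorem exists_selection (P : Protocol G v T N) :
    ∃ (q w : V → Fin 2 → Matrix (Fin 2) (Fin 2) ℂ) (s : V → Fin 2 → Fin N → Fin 2),
      (∀ j, q j 0 + q j 1 = 1) ∧ (∀ j, (q j 0 - q j 1) * (q j 0 - q j 1) = 1) ∧
      (∀ j, (∀ n, P.site n ≠ j) → q j 0 - q j 1 = 1 ∧ ∀ u, ∃ c : ℂ, w j u = c • 1) ∧
      ∀ u : V → Fin 2, tensorOp (fun j => w j (u j)) *
          tensorOp (P.siteBranch (List.finRange N).reverse
            fun n => s (P.site n) (u (P.site n)) n) =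
        tensorOp fun j => q j (u j) := by
  choose q w s h1 h2 h3 h4 using fun j => P.exists_mul_siteBranch (List.finRange N).reverse
    (List.nodup_reverse.2 (List.nodup_finRange N)) j
  refine ⟨q, w, s, h1, h2, fun j hj => h4 j fun n _ => hj n, fun u => ?_⟩
  rw [tensorOp_mul]
  congr 1
  funext j
  rw [← h3 j (u j)]
  congr 1
  refine P.siteBranch_congr _ fun n _ hn => ?_
  subst hn
  rfl

namespace IsStandardTeleportation

variable {P : Protocol G v T N} {φ : V → Fin 2 → ℂ} {i f : V}

/-- A measurement on `f` makes each branch operator singular there, so some row vector `γ`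
annihilates all branch states at `f`. The Pauli operators on `f` permute branch states up to sign,
so `γ`, `γX`, `γZ` and `γXZ` all annihilate them. These span all row vectors, so every branch
vanishes, and with it the evolved state. -/
theorem site_ne (h : P.IsStandardTeleportation φ i f) (n : Fin N) : P.site n ≠ f := by
  rintro rfl
  obtain ⟨q, w, s, h1, -, -, h4⟩ := P.exists_selection
  suffices h0 : ∀ s ψ,
      tensorOp (P.siteBranch (List.finRange N).reverse s) *ᵥ P.evolved φ i ψ = 0 by
    refine h.evolved_ne_zero (ψ := fun _ => 1) (fun e => one_ne_zero (congrFun e 0)) ?_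
    have hsum : ∑ u : V → Fin 2, tensorOp (fun j => q j (u j)) = 1 := by
      rw [sum_tensorOp, ← tensorOp_one]
      simp only [Fin.sum_univ_two, h1]
    rw [← Matrix.one_mulVec (P.evolved φ i _), ← hsum, Matrix.sum_mulVec]
    refine Finset.sum_eq_zero fun u _ => ?_
    rw [← h4, ← Matrix.mulVec_mulVec, h0, Matrix.mulVec_zero]
  intro s
  have hdet : (P.siteBranch (List.finRange N).reverse s (P.site n)).det = 0 := by
    have := map_list_prod Matrix.detMonoidHom ((List.finRange N).reverse.map fun m =>
      if P.site m = P.site n then (P.obs m).proj (s m) else 1)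
    refine this.trans (List.prod_eq_zero ?_)
    rw [List.map_map]
    refine List.mem_map.2 ⟨n, by simp, ?_⟩
    simp [QubitObservable.det_proj]
  obtain ⟨γ, hγ0, hγ⟩ := Matrix.exists_vecMul_eq_zero_iff.2 hdet
  set Ψ := fun ψ =>
    tensorOp (P.siteBranch (List.finRange N).reverse s) *ᵥ P.evolved φ i ψ with hΨ
  have hkill : ∀ ψ x, ∑ c, γ c * Ψ ψ (Function.update x (P.site n) c) = 0 := by
    intro ψ x
    have hz : onSite (P.site n) (Matrix.of fun _ => γ) *
        tensorOp (P.siteBranch (List.finRange N).reverse s) = 0 := by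
      rw [onSite, tensorOp_mul]
      ext y z
      rw [tensorOp_apply]
      refine Finset.prod_eq_zero (Finset.mem_univ (P.site n)) ?_
      rw [Function.update_self]
      exact congrFun hγ _
    have := congrFun (congrArg (· *ᵥ P.evolved φ i ψ) hz) x
    rw [← Matrix.mulVec_mulVec, onSite_mulVec, Matrix.zero_mulVec] at this
    exact this
  obtain ⟨d, hd, hX⟩ := h.exists_sign 1
  obtain ⟨d', hd', hZ⟩ := h.exists_sign 3
  have hne : ∀ (d : Fin N → Fin 2 → ℂ), (∀ n b, d n b = 1 ∨ d n b = -1) →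
      ∏ n, d n (s n) ≠ 0 := by
    intro d hd
    refine Finset.prod_ne_zero_iff.2 fun n _ => ?_
    rcases hd n (s n) with e | e <;> rw [e] <;> simp
  have step : ∀ (a : Fin 4) (d : Fin N → Fin 2 → ℂ), (∀ n b, d n b = 1 ∨ d n b = -1) →
      (∀ s ψ, (∏ n, d n (s n)) • (onSite (P.site n) (pauli a) *ᵥ
        (tensorOp (P.siteBranch (List.finRange N).reverse s) *ᵥ P.evolved φ i ψ)) =
      tensorOp (P.siteBranch (List.finRange N).reverse s) *ᵥ P.evolved φ i (pauli a *ᵥ ψ)) →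
      ∀ γ : Fin 2 → ℂ,
        (∀ ψ x, ∑ c, γ c * Ψ ψ (Function.update x (P.site n) c) = 0) →
        ∀ ψ x, ∑ c, (γ ᵥ* pauli a) c * Ψ ψ (Function.update x (P.site n) c) = 0 := by
    intro a d hd hX γ hγ ψ x
    have h1 := hγ (pauli a *ᵥ ψ) x
    simp only [hΨ] at h1
    rw [← hX] at h1
    simp only [Pi.smul_apply, smul_eq_mul, mul_left_comm (γ _), ← Finset.mul_sum] at h1
    have h2 := (mul_eq_zero.1 h1).resolve_left (hne d hd)
    rw [← h2]
    simp only [onSite_mulVec, Function.update_self, Function.update_idem, Matrix.vecMul,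
      dotProduct, Finset.sum_mul, Finset.mul_sum]
    rw [Finset.sum_comm]
    exact Finset.sum_congr rfl fun _ _ => Finset.sum_congr rfl fun _ _ => by ring
  have kX := step 1 d hd hX γ hkill
  have kZ := step 3 d' hd' hZ γ hkill
  have kXZ := step 3 d' hd' hZ _ kX
  intro ψ
  funext x
  have e0 := hkill ψ x
  have e1 := kX ψ x
  have e2 := kZ ψ x
  have e3 := kXZ ψ x
  simp [pauli, Matrix.vecMul, dotProduct, Fin.sum_univ_two] at e0 e1 e2 e3
  set t0 := Ψ ψ (Function.update x (P.site n) 0)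
  set t1 := Ψ ψ (Function.update x (P.site n) 1)
  have f0 : γ 0 * t0 = 0 := by linear_combination (e0 + e2) / 2
  have f1 : γ 1 * t1 = 0 := by linear_combination (e0 - e2) / 2
  have f2 : γ 1 * t0 = 0 := by linear_combination (e1 + e3) / 2
  have f3 : γ 0 * t1 = 0 := by linear_combination (e1 - e3) / 2
  have ht : t0 = 0 ∧ t1 = 0 := by
    by_cases g0 : γ 0 = 0
    · have g1 : γ 1 ≠ 0 := fun g1 => hγ0 (by funext b; fin_cases b <;> simp [g0, g1])
      exact ⟨(mul_eq_zero.1 f2).resolve_left g1, (mul_eq_zero.1 f1).resolve_left g1⟩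
    · exact ⟨(mul_eq_zero.1 f0).resolve_left g0, (mul_eq_zero.1 f3).resolve_left g0⟩
  have hx : x (P.site n) = 0 ∨ x (P.site n) = 1 := by
    generalize x (P.site n) = b
    fin_cases b <;> simp
  rcases hx with hx | hx
  · have := ht.1
    simp only [t0] at this
    rwa [← hx, Function.update_eq_self] at this
  · have := ht.2
    simp only [t1] at this
    rwa [← hx, Function.update_eq_self] at this

/-- Before the measurements, every logical Pauli operator is realized by that Pauli operator on
`f` and by a product of involutions of measured sites. -/
theorem exists_logical (h : P.IsStandardTeleportation φ i f) :
    ∃ A : V → Matrix (Fin 2) (Fin 2) ℂ, (∀ j, A j * A j = 1) ∧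
      (∀ j, (∀ n, P.site n ≠ j) → A j = 1) ∧
      ∀ a : Fin 4, ∃ e : V → Matrix (Fin 2) (Fin 2) ℂ,
        (∀ j, e j = 1 ∨ e j = -1 ∨ e j = A j ∨ e j = -A j) ∧
        ∀ ψ, (onSite f (pauli a) * tensorOp e) *ᵥ P.evolved φ i ψ =
          P.evolved φ i (pauli a *ᵥ ψ) := by
  obtain ⟨q, w, s, h1, h2, h3, h4⟩ := P.exists_selection
  refine ⟨fun j => q j 0 - q j 1, h2, fun j hj => (h3 j hj).1, fun a => ?_⟩
  obtain ⟨d, hd, hX⟩ := h.exists_sign a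
  -- Grouping the outcome signs by site makes the total sign a product over sites, so the sum over
  -- `u` factors into `∑ b, ε j b • q j b`.
  set ε : V → Fin 2 → ℂ := fun j b => ∏ n with P.site n = j, d n (s j b n) with hε
  have hε1 : ∀ j b, ε j b = 1 ∨ ε j b = -1 := by
    intro j b
    refine Finset.prod_induction _ (fun z => z = 1 ∨ z = -1) ?_ (Or.inl rfl) fun n _ => hd n _
    rintro x y (rfl | rfl) (rfl | rfl) <;> simp
  refine ⟨fun j => ∑ b, ε j b • q j b, fun j => ?_, fun ψ => ?_⟩
  · dsimp only
    rw [Fin.sum_univ_two, ← h1 j]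
    rcases hε1 j 0 with e0 | e0 <;> rcases hε1 j 1 with e1 | e1 <;> rw [e0, e1]
    · left; module
    · right; right; left; module
    · right; right; right; module
    · right; left; module
  · have hsum : ∑ u : V → Fin 2, tensorOp (fun j => q j (u j)) = 1 := by
      rw [sum_tensorOp, ← tensorOp_one]
      simp only [Fin.sum_univ_two, h1]
    rw [← sum_tensorOp, Finset.mul_sum, Matrix.sum_mulVec,
      ← Matrix.one_mulVec (P.evolved φ i (pauli a *ᵥ ψ)), ← hsum, Matrix.sum_mulVec]
    refine Finset.sum_congr rfl fun u _ => ?_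
    -- Since `f` is not measured, `w` is scalar there.
    have hc : Commute (tensorOp fun j => w j (u j)) (onSite f (pauli a)) := by
      refine tensorOp_commute fun j => ?_
      by_cases hj : j = f
      · subst hj
        obtain ⟨c, hc⟩ := (h3 j h.site_ne).2 (u j)
        rw [hc, commute_iff_eq, smul_mul_assoc, mul_smul_comm, one_mul, mul_one]
      · rw [Function.update_of_ne hj]
        exact Commute.one_right _
    have hq : (tensorOp fun j => w j (u j)) *ᵥ (tensorOp (P.siteBranch (List.finRange N).reverse
        fun n => s (P.site n) (u (P.site n)) n) *ᵥ P.evolved φ i ψ) =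
        tensorOp (fun j => q j (u j)) *ᵥ P.evolved φ i ψ := by
      rw [Matrix.mulVec_mulVec, h4]
    rw [← h4 u, ← Matrix.mulVec_mulVec (P.evolved φ i (pauli a *ᵥ ψ)), ← hX, Matrix.mulVec_smul,
      Matrix.mulVec_mulVec _ (tensorOp fun j => w j (u j)) (onSite f (pauli a)), hc.eq,
      ← Matrix.mulVec_mulVec _ (onSite f (pauli a)) (tensorOp fun j => w j (u j)), hq,
      tensorOp_smul, mul_smul_comm, Matrix.smul_mulVec,
      Matrix.mulVec_mulVec]
    congr 1
    rw [hε, ← Finset.prod_fiberwise Finset.univ P.site]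
    refine Finset.prod_congr rfl fun j _ => Finset.prod_congr rfl fun n hn => ?_
    rw [(Finset.mem_filter.1 hn).2]

/-- For every site `j`, two anticommuting logical Pauli operators can be realized such that the
first one does not involve `j`. -/
theorem exists_anticommuting (h : P.IsStandardTeleportation φ i f) (j : V) :
    ∃ (A : V → Matrix (Fin 2) (Fin 2) ℂ) (a b c : Matrix (Fin 2) (Fin 2) ℂ)
      (e e' : V → Matrix (Fin 2) (Fin 2) ℂ),
      (∀ k, (∀ n, P.site n ≠ k) → A k = 1) ∧ c * (a * b) = 1 ∧ a * b = -(b * a) ∧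
      (∀ k, e k = 1 ∨ e k = -1 ∨ e k = A k ∨ e k = -A k) ∧
      (∀ k, e' k = 1 ∨ e' k = -1 ∨ e' k = A k ∨ e' k = -A k) ∧
      (∀ ψ, (onSite f a * tensorOp e) *ᵥ P.evolved φ i ψ = P.evolved φ i (a *ᵥ ψ)) ∧
      (∀ ψ, (onSite f b * tensorOp e') *ᵥ P.evolved φ i ψ = P.evolved φ i (b *ᵥ ψ)) ∧
      (e j = 1 ∨ e j = -1) := by
  obtain ⟨A, hAA, hA, he⟩ := h.exists_logical
  obtain ⟨x, hx, eX⟩ := he 1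
  obtain ⟨z, hz, eZ⟩ := he 3
  have hX : pauli 1 * pauli 1 = 1 := pauli_mul_self 1
  have hZ : pauli 3 * pauli 3 = 1 := pauli_mul_self 3
  have hXZ : pauli 1 * pauli 3 = -(pauli 3 * pauli 1) := by simp [pauli]
  have hZX : pauli 3 * pauli 1 = -(pauli 1 * pauli 3) := by rw [hXZ, neg_neg]
  by_cases hxj : x j = 1 ∨ x j = -1
  · refine ⟨A, _, _, pauli 3 * pauli 1, x, z, hA, ?_, hXZ, hx, hz, eX, eZ, hxj⟩
    rw [mul_assoc, ← mul_assoc _ _ (pauli 3), hX, one_mul, hZ]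
  by_cases hzj : z j = 1 ∨ z j = -1
  · refine ⟨A, _, _, pauli 1 * pauli 3, z, x, hA, ?_, hZX, hz, hx, eZ, eX, hzj⟩
    rw [mul_assoc, ← mul_assoc _ _ (pauli 1), hZ, one_mul, hX]
  -- In the remaining case X and Z both carry `±A j`, and `A j * A j = 1` makes their product
  -- trivial on `j`.
  have hprod : ∀ k, x k * z k = 1 ∨ x k * z k = -1 ∨ x k * z k = A k ∨ x k * z k = -A k := by
    intro k
    have := hAA k
    rcases hx k with e | e | e | e <;> rcases hz k with e' | e' | e' | e' <;>
      simp [e, e', this]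
  refine ⟨A, pauli 1 * pauli 3, pauli 3, pauli 1, fun k => x k * z k, z, hA, ?_, ?_, hprod, hz,
    fun ψ => ?_, eZ, ?_⟩
  · rw [mul_assoc, hZ, mul_one, hX]
  · rw [mul_assoc, hZ, ← mul_assoc, hZX, neg_mul, mul_assoc, hZ, mul_one, neg_neg]
  · have hc : Commute (onSite f (pauli 3)) (tensorOp x) := by
      refine tensorOp_commute fun k => ?_
      by_cases hk : k = f
      · subst hk
        have := hx k
        rw [hA k h.site_ne] at this
        rcases this with e | e | e | e <;> simp [e]
      · rw [Function.update_of_ne hk]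
        exact Commute.one_left _
    rw [← onSite_mul, ← tensorOp_mul, mul_assoc, ← mul_assoc _ (tensorOp x), hc.eq, mul_assoc,
      ← mul_assoc, ← Matrix.mulVec_mulVec, eZ, eX, Matrix.mulVec_mulVec]
  · dsimp only
    have := hAA j
    push Not at hxj hzj
    rcases hx j with e | e | e | e
    · exact absurd e hxj.1
    · exact absurd e hxj.2
    all_goals
      rcases hz j with e' | e' | e' | e'
      · exact absurd e' hzj.1
      · exact absurd e' hzj.2
      all_goals simp [e, e', this]

/-! ### The separation argument. -/

/-- There is no set of sites around `i` that separates the light cone of `f` and the light cones of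
all measured sites but one. -/
theorem not_separated (h : P.IsStandardTeleportation φ i f) {D : Set V} (hi : i ∈ D)
    (hf : Disjoint (P.cone f) D) (j : V)
    (hD : ∀ n, P.site n ≠ j → P.cone (P.site n) ⊆ D ∨ Disjoint (P.cone (P.site n)) D) : False := by
  classical
  obtain ⟨A, a, b, c, e, e', hA, hc, hab, he, he', ea, eb, hj⟩ := h.exists_anticommuting j
  have hUU := P.circuit_mul_conjTranspose
  have hUU' := P.circuit_conjTranspose_mul
  set U := P.circuit with hU
  have ecomm : ∀ k (M M' : Matrix (Fin 2) (Fin 2) ℂ),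
      (M = 1 ∨ M = -1 ∨ M = A k ∨ M = -A k) → (M' = 1 ∨ M' = -1 ∨ M' = A k ∨ M' = -A k) →
      Commute M M' := by
    intro k M M' hM hM'
    rcases hM with r | r | r | r <;> rcases hM' with r' | r' | r' | r' <;> simp [r, r']
  have cf : ∀ (M : Matrix (Fin 2) (Fin 2) ℂ) (g : V → Matrix (Fin 2) (Fin 2) ℂ),
      (∀ k, g k = 1 ∨ g k = -1 ∨ g k = A k ∨ g k = -A k) →
      Commute (tensorOp g) (onSite f M) := by
    intro M g hg
    refine tensorOp_commute fun k => ?_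
    by_cases hk : k = f
    · subst hk
      have := hg k
      rw [hA k h.site_ne] at this
      rcases this with r | r | r | r <;> simp [r]
    · rw [Function.update_of_ne hk]
      exact Commute.one_right _
  set near : V → Prop := fun k => P.cone k ⊆ D with hnear
  -- `g` collects the factors of `e` with cone inside `D`. The rest, `g'`, has cones outside `D`,
  -- except possibly at `j`, where it is then `±1`.
  set g : V → Matrix (Fin 2) (Fin 2) ℂ := fun k => if near k then e k else 1 with hg
  set g' : V → Matrix (Fin 2) (Fin 2) ℂ := fun k => if near k then 1 else e k with hg'
  have hgA : ∀ k, g k = 1 ∨ g k = -1 ∨ g k = A k ∨ g k = -A k := by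
    intro k
    simp only [hg]
    split_ifs
    · exact he k
    · exact Or.inl rfl
  have hgg : tensorOp g * tensorOp g' = tensorOp e := by
    rw [tensorOp_mul]
    congr 1
    funext k
    simp only [hg, hg']
    split_ifs <;> simp
  have h1 : Uᴴ * tensorOp g * U ∈ localAlg D := by
    refine P.circuit_conj_tensorOp_mem g fun k => ?_
    by_cases hk : near k
    · exact Or.inl hk
    · exact Or.inr (Or.inl (if_neg hk))
  have h2 : Uᴴ * (onSite f a * tensorOp g') * U ∈ localAlg Dᶜ := by
    have h3 : Uᴴ * tensorOp g' * U ∈ localAlg Dᶜ := by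
      refine P.circuit_conj_tensorOp_mem g' fun k => ?_
      by_cases hk : near k
      · exact Or.inr (Or.inl (if_pos hk))
      have hk' : g' k = e k := if_neg hk
      rw [hk']
      by_cases hkj : k = j
      · subst hkj
        exact Or.inr hj
      by_cases hm : ∃ n, P.site n = k
      · obtain ⟨n, rfl⟩ := hm
        exact Or.inl (Set.subset_compl_iff_disjoint_right.2 ((hD n hkj).resolve_left hk))
      · push Not at hm
        have := he k
        rw [hA k hm] at this
        tauto
    have h4 : Uᴴ * onSite f a * U ∈ localAlg Dᶜ :=
      localAlg_mono (Set.subset_compl_iff_disjoint_right.2 hf) (P.circuit_conj_onSite_mem f a)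
    convert mul_mem h4 h3 using 1
    calc Uᴴ * (onSite f a * tensorOp g') * U
        = Uᴴ * onSite f a * 1 * tensorOp g' * U := by noncomm_ring
      _ = _ := by rw [← hUU]; noncomm_ring
  have h5 : ∀ ψ, (Uᴴ * tensorOp g * U * (Uᴴ * (onSite f a * tensorOp g') * U)) *ᵥ
      prodState (Function.update φ i ψ) = prodState (Function.update φ i (a *ᵥ ψ)) := by
    intro ψ
    have : Uᴴ * tensorOp g * U * (Uᴴ * (onSite f a * tensorOp g') * U) =
        Uᴴ * (onSite f a * tensorOp e * U) := by
      calc _ = Uᴴ * tensorOp g * (U * Uᴴ) * onSite f a * tensorOp g' * U := by noncomm_ring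
        _ = Uᴴ * (tensorOp g * onSite f a) * tensorOp g' * U := by rw [hUU]; noncomm_ring
        _ = _ := by rw [(cf a g hgA).eq, ← hgg]; noncomm_ring
    have h6 := ea ψ
    rw [evolved, evolved, Matrix.mulVec_mulVec] at h6
    rw [this, ← Matrix.mulVec_mulVec, h6, Matrix.mulVec_mulVec, hUU', Matrix.one_mulVec]
  have hφ : ∀ k, k ≠ i → φ k ≠ 0 := by
    intro k hk h0
    have := h.normalized k hk
    simp [h0] at this
  obtain ⟨μ, ν, hν, h6⟩ := exists_smul_mulVec_prodState h1 h2 hi hφ a h5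
  have h7 : ∀ ψ, μ • (tensorOp g *ᵥ P.evolved φ i ψ) = ν • P.evolved φ i (a *ᵥ ψ) := by
    intro ψ
    have := congrArg (U *ᵥ ·) (h6 ψ)
    simp only [Matrix.mulVec_smul, Matrix.mulVec_mulVec, ← mul_assoc, hUU, one_mul] at this
    rwa [← Matrix.mulVec_mulVec] at this
  -- `g` implements `a` up to scalars but is a scalar on `f`, and on every other site it commutes
  -- with `e'`. So it cannot detect that `a` and `b` anticommute.
  have hcomm : Commute (tensorOp g) (onSite f b * tensorOp e') :=
    (cf b g hgA).mul_right (tensorOp_commute fun k => ecomm k _ _ (hgA k) (he' k))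
  obtain ⟨ψ, hψ⟩ : ∃ ψ : Fin 2 → ℂ, ψ ≠ 0 := exists_ne 0
  have h8 : P.evolved φ i (a *ᵥ (b *ᵥ ψ)) = P.evolved φ i (b *ᵥ (a *ᵥ ψ)) := by
    have h9 := h7 (b *ᵥ ψ)
    rw [← eb, Matrix.mulVec_mulVec, hcomm.eq, ← Matrix.mulVec_mulVec, ← Matrix.mulVec_smul, h7,
      Matrix.mulVec_smul, eb] at h9
    exact (smul_right_injective _ hν h9).symm
  have h10 : ∀ ψ, P.evolved φ i (-ψ) = -P.evolved φ i ψ := by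
    intro ψ
    rw [evolved, evolved, ← neg_one_smul ℂ ψ, prodState_update_smul, Matrix.mulVec_smul,
      neg_one_smul]
  rw [Matrix.mulVec_mulVec, Matrix.mulVec_mulVec, hab, Matrix.neg_mulVec, h10, neg_eq_self] at h8
  refine h.evolved_ne_zero (fun h0 => hψ ?_) h8
  have h11 : (a * b) *ᵥ ψ = 0 := by rw [hab, Matrix.neg_mulVec, h0, neg_zero]
  rw [← Matrix.one_mulVec ψ, ← hc, ← Matrix.mulVec_mulVec, h11, Matrix.mulVec_zero]

end IsStandardTeleportation

/-! ### Geometry of light cones and straddling measurements. -/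

/-- The block of a site in the first layer; without layers, every site is its own block. -/
def firstBlock (P : Protocol G v T N) (x : V) : V :=
  if h : 0 < T then (P.layer ⟨0, h⟩).block x else x

theorem dist_le_of_firstBlock (P : Protocol G v T N) {x y : V}
    (h : P.firstBlock x = P.firstBlock y) : G.dist x y ≤ v := by
  unfold firstBlock at h
  split_ifs at h with hT
  · exact (P.layer _).dist_le x y h
  · rw [h, SimpleGraph.dist_self]
    exact Nat.zero_le v

/-- A path of gates starts with a gate of the first layer. -/
theorem Reach.exists_firstBlock {P : Protocol G v T N} (hG : G.Connected) {t : ℕ} (ht : t + 1 ≤ T)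
    {x y : V} (h : P.Reach (t + 1) x y) :
    ∃ x', P.firstBlock x = P.firstBlock x' ∧ G.dist x' y ≤ v * t := by
  induction t generalizing y with
  | zero =>
    obtain ⟨z, rfl, h⟩ := h
    exact ⟨y, by simpa only [firstBlock, dif_pos (show 0 < T from ht)] using h ht, by simp⟩
  | succ t ih =>
    obtain ⟨z, hz, h⟩ := h
    obtain ⟨x', hx, hd⟩ := ih (Nat.le_of_succ_le ht) hz
    refine ⟨x', hx, (hG.dist_triangle (v := z)).trans ?_⟩
    rw [Nat.mul_succ]
    exact Nat.add_le_add hd ((P.layer _).dist_le z y (h ht))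

theorem Reach.of_firstBlock_eq {P : Protocol G v T N} {t : ℕ} (ht : t + 1 ≤ T) {x x' y : V}
    (h : P.Reach (t + 1) x y) (hx : P.firstBlock x = P.firstBlock x') :
    P.Reach (t + 1) x' y := by
  induction t generalizing y with
  | zero =>
    obtain ⟨z, rfl, h⟩ := h
    simp only [firstBlock, dif_pos (show 0 < T from ht)] at hx
    exact ⟨x', rfl, fun h0 => hx.symm.trans (h h0)⟩
  | succ t ih =>
    obtain ⟨z, hz, h⟩ := h
    exact ⟨z, ih (Nat.le_of_succ_le ht) hz, h⟩

theorem mem_cone_of_firstBlock_eq {P : Protocol G v T N} {x x' y : V} (h : x ∈ P.cone y)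
    (hx : P.firstBlock x = P.firstBlock x') : x' ∈ P.cone y := by
  rcases T with _ | T
  · rw [firstBlock, firstBlock, dif_neg (lt_irrefl 0), dif_neg (lt_irrefl 0)] at hx
    exact hx ▸ h
  · exact Reach.of_firstBlock_eq (P := P) le_rfl h hx

theorem dist_lastGate_le (P : Protocol G v T N) {n : Fin N} {x y : V} (hx : x ∈ P.lastGate n)
    (hy : y ∈ P.lastGate n) : G.dist x y ≤ v := by
  obtain ⟨t, ht, hx⟩ := hx
  obtain ⟨t', ht', hy⟩ := hy
  obtain rfl : t = t' := Fin.ext (by omega)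
  exact (P.layer t).dist_le x y (hx.trans hy.symm)

/-- The light cone of the site of measurement `n` lies partly in `D` and partly outside. -/
def Straddles (P : Protocol G v T N) (D : Set V) (n : Fin N) : Prop :=
  ¬ Disjoint (P.cone (P.site n)) D ∧ ¬ P.cone (P.site n) ⊆ D

namespace IsStandardTeleportation

variable {P : Protocol G v T N} {φ : V → Fin 2 → ℂ} {i f : V}

/-- The site is idle after its measurement, so its cone does not grow in later layers. -/
theorem reach_of_mem_cone (h : P.IsStandardTeleportation φ i f) (n : Fin N) {x : V}
    (hx : x ∈ P.cone (P.site n)) : P.Reach (P.time n) x (P.site n) := by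
  have key : ∀ t, P.time n ≤ t → t ≤ T → P.Reach t x (P.site n) →
      P.Reach (P.time n) x (P.site n) := by
    intro t ht
    induction t, ht using Nat.le_induction with
    | base => exact fun _ hr => hr
    | succ t ht ih =>
      rintro hT ⟨z, hz, hb⟩
      rw [(h.untouched n ⟨t, hT⟩ ht).1 z (hb hT)] at hz
      exact ih (Nat.le_of_succ_le hT) hz
  exact key T (P.time_le n) le_rfl hx

theorem firstBlock_eq_of_time_le (h : P.IsStandardTeleportation φ i f) {n : Fin N}
    (hn : P.time n ≤ 1) {x x' : V} (hx : x ∈ P.cone (P.site n)) (hx' : x' ∈ P.cone (P.site n)) :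
    P.firstBlock x = P.firstBlock x' := by
  have h1 := h.reach_of_mem_cone n hx
  have h2 := h.reach_of_mem_cone n hx'
  rcases Nat.le_one_iff_eq_zero_or_eq_one.1 hn with e | e
  · rw [e] at h1 h2
    rw [show x = x' from Eq.trans h1 (Eq.symm h2)]
  · have hT : 0 < T := by have := P.time_le n; omega
    rw [e] at h1 h2
    obtain ⟨z, rfl, h1⟩ := h1
    obtain ⟨z, rfl, h2⟩ := h2
    simp only [firstBlock, dif_pos hT]
    exact (h1 hT).trans (h2 hT).symm

/-- Of the `t + 2` layers before the measurement, the first and the last are split off; only the `t`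
layers between them contribute to the distance. -/
theorem exists_mem_lastGate (h : P.IsStandardTeleportation φ i f) (hG : G.Connected) {n : Fin N}
    {t : ℕ} (ht : P.time n = t + 2) {x : V} (hx : x ∈ P.cone (P.site n)) :
    ∃ z ∈ P.lastGate n, ∃ x', P.firstBlock x = P.firstBlock x' ∧ G.dist x' z ≤ v * t := by
  have h1 := h.reach_of_mem_cone n hx
  have hT : t + 1 < T := by have := P.time_le n; omega
  rw [ht] at h1
  obtain ⟨z, hz, hb⟩ := h1
  obtain ⟨x', hx', hd⟩ := hz.exists_firstBlock hG hT.le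
  exact ⟨z, ⟨⟨t + 1, hT⟩, ht.symm, hb hT⟩, x', hx', hd⟩

/-- With at most one layer before the measurement, the cone lies in a single first-layer block, and
a union of such blocks cannot cut it. -/
theorem two_le_time (h : P.IsStandardTeleportation φ i f) {D : Set V}
    (hD : ∀ x x', x ∈ D → P.firstBlock x = P.firstBlock x' → x' ∈ D) {n : Fin N}
    (hn : P.Straddles D n) : 2 ≤ P.time n := by
  by_contra! hlt
  obtain ⟨x, hx, hxD⟩ := Set.not_disjoint_iff.1 hn.1
  exact hn.2 fun x' hx' =>
    hD x x' hxD (h.firstBlock_eq_of_time_le (Nat.le_of_lt_succ hlt) hx hx')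

theorem exists_straddling_pair (h : P.IsStandardTeleportation φ i f) {D : Set V} (hi : i ∈ D)
    (hf : Disjoint (P.cone f) D) :
    ∃ n n', P.site n ≠ P.site n' ∧ P.Straddles D n ∧ P.Straddles D n' := by
  have key : ∀ j, ∃ n, P.site n ≠ j ∧ P.Straddles D n := by
    intro j
    by_contra! hno
    refine h.not_separated hi hf j fun n hn => ?_
    have := hno n hn
    unfold Straddles at this
    tauto
  -- The first exempted site is arbitrary; exempting the site just found then yields a second one.
  obtain ⟨n, -, hn⟩ := key f
  obtain ⟨n', hne, hn'⟩ := key (P.site n)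
  exact ⟨n, n', hne.symm, hn, hn'⟩

/-- This is where `L > vT` enters: a common site would join `i` to `f` by one first-layer gate and
`T - 1` further gates. -/
theorem disjoint_cone_firstBlock (h : P.IsStandardTeleportation φ i f) (hG : G.Connected) :
    Disjoint (P.cone f) {x | P.firstBlock i = P.firstBlock x} := by
  refine Set.disjoint_left.2 fun x hx hxi => ?_
  have hL := h.lt_dist
  rcases T with _ | T
  · simp only [Set.mem_ofPred_eq, firstBlock, dif_neg (lt_irrefl 0)] at hxi
    rw [hxi, show x = f from hx, SimpleGraph.dist_self] at hL
    exact absurd hL (Nat.not_lt_zero _)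
  · obtain ⟨x', hx', hd⟩ := Reach.exists_firstBlock (P := P) hG le_rfl hx
    have h1 := P.dist_le_of_firstBlock (Eq.trans hxi hx')
    have h2 := hG.dist_triangle (u := i) (v := x') (w := f)
    rw [Nat.mul_succ] at hL
    omega

/-- A measurement whose light cone meets the block of `i` has a position near `i`. -/
theorem exists_lastGate_near_initial (h : P.IsStandardTeleportation φ i f) (hG : G.Connected)
    {n : Fin N} {t : ℕ} (ht : P.time n = t + 2)
    (hn : ¬ Disjoint (P.cone (P.site n)) {x | P.firstBlock i = P.firstBlock x}) :
    ∃ y ∈ P.lastGate n, G.dist i y ≤ v + v * t := by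
  obtain ⟨x, hx, hxi⟩ := Set.not_disjoint_iff.1 hn
  obtain ⟨z, hz, x', hx', hd⟩ := h.exists_mem_lastGate hG ht hx
  have h1 := P.dist_le_of_firstBlock (Eq.trans hxi hx')
  exact ⟨z, hz, (hG.dist_triangle (v := x')).trans (Nat.add_le_add h1 hd)⟩

/-- Measurements whose light cones meet are near to each other. -/
theorem exists_lastGate_near (h : P.IsStandardTeleportation φ i f) (hG : G.Connected)
    {n n' : Fin N} {t t' : ℕ} (ht : P.time n = t + 2) (ht' : P.time n' = t' + 2)
    (hn : ¬ Disjoint (P.cone (P.site n)) (P.cone (P.site n'))) {y : V} (hy : y ∈ P.lastGate n) :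
    ∃ y' ∈ P.lastGate n', G.dist y y' ≤ v + v * t + v + v * t' := by
  obtain ⟨x, hx, hx'⟩ := Set.not_disjoint_iff.1 hn
  obtain ⟨z, hz, a, ha, hd⟩ := h.exists_mem_lastGate hG ht hx
  obtain ⟨z', hz', a', ha', hd'⟩ := h.exists_mem_lastGate hG ht' hx'
  refine ⟨z', hz', ?_⟩
  have h1 := P.dist_lastGate_le hy hz
  have h2 := P.dist_le_of_firstBlock (ha.symm.trans ha')
  have h3 := hG.dist_triangle (u := y) (v := z) (w := z')
  have h4 := hG.dist_triangle (u := z) (v := a) (w := z')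
  have h5 := hG.dist_triangle (u := a) (v := a') (w := z')
  rw [SimpleGraph.dist_comm] at hd
  omega

/-- A measurement whose light cone meets the one of `f` is near `f`. -/
theorem dist_final_le (h : P.IsStandardTeleportation φ i f) (hG : G.Connected)
    {n : Fin N} {t : ℕ} (ht : P.time n = t + 2)
    (hn : ¬ Disjoint (P.cone f) (P.cone (P.site n))) {y : V} (hy : y ∈ P.lastGate n) :
    G.dist y f ≤ v + v * t + v + v * (T - 1) := by
  obtain ⟨x, hx, hx'⟩ := Set.not_disjoint_iff.1 hn
  obtain ⟨z, hz, a, ha, hd⟩ := h.exists_mem_lastGate hG ht hx'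
  have hT : T - 1 + 1 = T := by have := P.time_le n; omega
  have hr : P.Reach (T - 1 + 1) x f := by rw [hT]; exact hx
  obtain ⟨a', ha', hd'⟩ := hr.exists_firstBlock hG hT.le
  have h1 := P.dist_lastGate_le hy hz
  have h2 := P.dist_le_of_firstBlock (ha.symm.trans ha')
  have h3 := hG.dist_triangle (u := y) (v := z) (w := f)
  have h4 := hG.dist_triangle (u := z) (v := a) (w := f)
  have h5 := hG.dist_triangle (u := a) (v := a') (w := f)
  rw [SimpleGraph.dist_comm] at hd
  omega

theorem dist_le_of_two_measurements {P : Protocol G v T 2} {φ : V → Fin 2 → ℂ}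
    (h : P.IsStandardTeleportation φ i f) (hG : G.Connected) (n : Fin 2) :
    2 ≤ P.time n ∧ G.dist i f + 2 * v ≤ v * T + 2 * v * P.time n := by
  have hpair : ∀ D : Set V, i ∈ D → Disjoint (P.cone f) D → P.Straddles D n := by
    intro D hi hf
    obtain ⟨m, m', hne, hm, hm'⟩ := h.exists_straddling_pair hi hf
    have : n = m ∨ n = m' := by
      have : m ≠ m' := fun e => hne (e ▸ rfl)
      omega
    rcases this with rfl | rfl
    · exact hm
    · exact hm'
  have hdis := h.disjoint_cone_firstBlock hG
  -- The two choices of `D` are extreme: straddling the block of `i` places a measurement near `i`,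
  -- straddling the complement of the cone of `f` places it near `f`.
  have h1 := hpair {x | P.firstBlock i = P.firstBlock x} rfl hdis
  have h2 := hpair (P.cone f)ᶜ (fun hi => Set.disjoint_left.1 hdis hi rfl) disjoint_compl_right
  have htime := h.two_le_time (D := {x | P.firstBlock i = P.firstBlock x})
    (fun x x' hx e => Eq.trans hx e) h1
  obtain ⟨t, ht⟩ := Nat.exists_eq_add_of_le' htime
  refine ⟨htime, ?_⟩
  obtain ⟨y, hy, hd⟩ := h.exists_lastGate_near_initial hG ht h1.1
  have hn : ¬ Disjoint (P.cone f) (P.cone (P.site n)) := fun hdj =>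
    h2.2 (Set.subset_compl_iff_disjoint_left.2 hdj)
  have hd' := h.dist_final_le hG ht hn hy
  have h3 := hG.dist_triangle (u := i) (v := y) (w := f)
  obtain ⟨r, rfl⟩ : ∃ r, T = r + 1 := ⟨T - 1, by have := P.time_le n; omega⟩
  rw [ht]
  rw [Nat.add_sub_cancel] at hd'
  nlinarith

end IsStandardTeleportation

/-! ### Growing regions and the chain of pairs. -/

/-- The sites that are connected to `i` by the light cones of at most `s` successive
measurements. -/
def region (P : Protocol G v T N) (i : V) : ℕ → Set V
  | 0 => {x | P.firstBlock i = P.firstBlock x}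
  | s + 1 => P.region i s ∪
      {x | ∃ n, ¬ Disjoint (P.cone (P.site n)) (P.region i s) ∧ x ∈ P.cone (P.site n)}

theorem region_mono (P : Protocol G v T N) (i : V) : Monotone (P.region i) :=
  monotone_nat_of_le_succ fun _ => Set.subset_union_left

theorem mem_region_self (P : Protocol G v T N) (i : V) (s : ℕ) : i ∈ P.region i s :=
  P.region_mono i (Nat.zero_le s) rfl

theorem mem_region_of_firstBlock_eq (P : Protocol G v T N) (i : V) (s : ℕ) (x x' : V)
    (h : x ∈ P.region i s) (hx : P.firstBlock x = P.firstBlock x') : x' ∈ P.region i s := by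
  induction s with
  | zero => exact Eq.trans h hx
  | succ s ih =>
    rcases h with h | ⟨n, hn, h⟩
    · exact Or.inl (ih h)
    · exact Or.inr ⟨n, hn, mem_cone_of_firstBlock_eq h hx⟩

theorem Straddles.subset_succ {P : Protocol G v T N} {i : V} {s : ℕ} {n : Fin N}
    (h : P.Straddles (P.region i s) n) : P.cone (P.site n) ⊆ P.region i (s + 1) :=
  fun _ hx => Or.inr ⟨n, h.1, hx⟩

/-- A set that meets the region of step `s + 1` but not the one of step `s` meets the light cone
of a measurement that straddles the latter. -/
theorem exists_straddles_of_disjoint (P : Protocol G v T N) (i : V) {s : ℕ} {C : Set V}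
    (h : ¬ Disjoint C (P.region i (s + 1))) (h' : Disjoint C (P.region i s)) :
    ∃ n, P.Straddles (P.region i s) n ∧ ¬ Disjoint C (P.cone (P.site n)) := by
  obtain ⟨x, hx, hx' | ⟨n, hn, hx'⟩⟩ := Set.not_disjoint_iff.1 h
  · exact absurd hx' (Set.disjoint_left.1 h' hx)
  · exact ⟨n, ⟨hn, fun hs => Set.disjoint_left.1 h' hx (hs hx')⟩,
      Set.not_disjoint_iff.2 ⟨x, hx, hx'⟩⟩

namespace IsStandardTeleportation

variable {P : Protocol G v T N} {φ : V → Fin 2 → ℂ} {i f : V}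

theorem exists_time_eq (h : P.IsStandardTeleportation φ i f) {s : ℕ} {n : Fin N}
    (hn : P.Straddles (P.region i s) n) :
    ∃ r t, T = r + 2 ∧ t ≤ r ∧ P.time n = t + 2 := by
  have h1 := h.two_le_time (P.mem_region_of_firstBlock_eq i s) hn
  have h2 := P.time_le n
  exact ⟨T - 2, P.time n - 2, by omega, by omega, by omega⟩

/-- A chain of pairs of measurements from `i` to a given pair that straddles the region of
step `s`. -/
theorem exists_chain (h : P.IsStandardTeleportation φ i f) (hG : G.Connected) (s : ℕ)
    (hf : Disjoint (P.cone f) (P.region i s)) (p : Fin 2 → Fin N)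
    (hp : P.site (p 0) ≠ P.site (p 1)) (hps : ∀ b, P.Straddles (P.region i s) (p b)) :
    ∃ (m : ℕ → Fin 2 → Fin N) (y : ℕ → Fin 2 → V), m s = p ∧
      (∀ k ≤ s, P.site (m k 0) ≠ P.site (m k 1)) ∧
      (∀ k ≤ s, ∀ b, P.Straddles (P.region i k) (m k b)) ∧
      (∀ k ≤ s, ∀ b, y k b ∈ P.lastGate (m k b)) ∧
      (∀ b, G.dist i (y 0 b) ≤ v * (T - 1)) ∧
      ∀ k < s, ∀ b, ∃ b', G.dist (y k b') (y (k + 1) b) ≤ 2 * v * (T - 1) := by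
  induction s generalizing p with
  | zero =>
    have : ∀ b, ∃ y ∈ P.lastGate (p b), G.dist i y ≤ v * (T - 1) := by
      intro b
      obtain ⟨r, t, rfl, htr, ht⟩ := h.exists_time_eq (hps b)
      obtain ⟨y, hy, hd⟩ := h.exists_lastGate_near_initial hG ht (hps b).1
      refine ⟨y, hy, hd.trans ?_⟩
      have := Nat.mul_le_mul_left v htr
      rw [show r + 2 - 1 = r + 1 from rfl, Nat.mul_succ]
      omega
    choose y hy hd using this
    refine ⟨fun _ => p, fun _ => y, rfl, fun _ _ => hp, ?_, fun _ _ => hy, hd, fun k hk => ?_⟩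
    · intro k hk
      rw [Nat.le_zero.1 hk]
      exact hps
    · exact absurd hk (Nat.not_lt_zero k)
  | succ s ih =>
    have hfs : Disjoint (P.cone f) (P.region i s) :=
      hf.mono_right (P.region_mono i (Nat.le_succ s))
    have hpar : ∀ b, ∃ n, P.Straddles (P.region i s) n ∧
        ¬ Disjoint (P.cone (P.site (p b))) (P.cone (P.site n)) := by
      intro b
      -- If the cone of `p b` met the region of step `s`, it would already lie in that of step `s +
      -- 1` and could not straddle it.
      refine P.exists_straddles_of_disjoint i (hps b).1 ?_
      by_contra hd
      exact (hps b).2 fun x hx => Or.inr ⟨p b, hd, hx⟩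
    choose n hn hpn using hpar
    obtain ⟨p', hp', hps', hpp'⟩ : ∃ p' : Fin 2 → Fin N, P.site (p' 0) ≠ P.site (p' 1) ∧
        (∀ b, P.Straddles (P.region i s) (p' b)) ∧
        ∀ b, ∃ b', P.site (n b) = P.site (p' b') := by
      -- Both members may have predecessors on the same site; the previous pair is then completed by
      -- another straddling measurement.
      by_cases he : P.site (n 0) = P.site (n 1)
      · obtain ⟨q, hq, hqs⟩ : ∃ q, P.site (n 0) ≠ P.site q ∧ P.Straddles (P.region i s) q := by
          obtain ⟨q, q', hqq, hq, hq'⟩ :=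
            h.exists_straddling_pair (P.mem_region_self i s) hfs
          by_cases e : P.site (n 0) = P.site q
          · exact ⟨q', fun e' => hqq (e.symm.trans e'), hq'⟩
          · exact ⟨q, e, hq⟩
        refine ⟨![n 0, q], hq, fun b => ?_, fun b => ⟨0, ?_⟩⟩
        · fin_cases b
          · exact hn 0
          · exact hqs
        · fin_cases b
          · rfl
          · exact he.symm
      · exact ⟨n, he, hn, fun b => ⟨b, rfl⟩⟩
    obtain ⟨m, y, rfl, h1, h2, h3, h4, h5⟩ := ih hfs p' hp' hps'
    have hlink : ∀ b, ∃ y' ∈ P.lastGate (p b), ∃ b', G.dist (y s b') y' ≤ 2 * v * (T - 1) := by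
      intro b
      obtain ⟨b', hb'⟩ := hpp' b
      obtain ⟨r, t, hr, htr, ht⟩ := h.exists_time_eq (hps b)
      obtain ⟨r', t', hr', htr', ht'⟩ := h.exists_time_eq (hps' b')
      obtain rfl : r = r' := by omega
      have hnd := hpn b
      rw [hb', disjoint_comm] at hnd
      obtain ⟨y', hy', hd⟩ := h.exists_lastGate_near hG ht' ht hnd (h3 s le_rfl b')
      refine ⟨y', hy', b', hd.trans ?_⟩
      have e1 := Nat.mul_le_mul_left v htr
      have e2 := Nat.mul_le_mul_left v htr'
      rw [hr, show r + 2 - 1 = r + 1 from rfl, Nat.mul_succ, mul_assoc]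
      omega
    choose y' hy' b' hd using hlink
    have hlt : ∀ {k}, k ≤ s → k ≠ s + 1 := fun hk e => by omega
    refine ⟨Function.update m (s + 1) p, Function.update y (s + 1) y', by simp, fun k hk => ?_,
      fun k hk => ?_, fun k hk => ?_, ?_, fun k hk => ?_⟩
    · rcases Nat.le_succ_iff.1 hk with hk | rfl
      · simpa [Function.update_of_ne (hlt hk)] using h1 k hk
      · simpa using hp
    · rcases Nat.le_succ_iff.1 hk with hk | rfl
      · simpa [Function.update_of_ne (hlt hk)] using h2 k hk
      · simpa using hps
    · rcases Nat.le_succ_iff.1 hk with hk | rfl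
      · simpa [Function.update_of_ne (hlt hk)] using h3 k hk
      · simpa using hy'
    · simpa using h4
    · rcases Nat.lt_succ_iff_lt_or_eq.1 hk with hk | rfl
      · rw [Function.update_of_ne (hlt hk.le), Function.update_of_ne (hlt hk)]
        exact h5 k hk
      · rw [Function.update_of_ne (hlt le_rfl), Function.update_self]
        exact fun b => ⟨b' b, hd b⟩

/-- As long as the cone of `f` is missed, a straddling measurement makes the region strictly larger,
which must end in a finite graph. -/
theorem exists_region_meets (h : P.IsStandardTeleportation φ i f) :
    ∃ s, ¬ Disjoint (P.cone f) (P.region i s) := by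
  by_contra! hno
  refine not_injective_infinite_finite (P.region i)
    (strictMono_nat_of_lt_succ fun s => ?_).injective
  obtain ⟨n, -, -, hn, -⟩ := h.exists_straddling_pair (P.mem_region_self i s) (hno s)
  exact ⟨P.region_mono i (Nat.le_succ s), fun hs => hn.2 (hn.subset_succ.trans hs)⟩

theorem exists_hasPairChain (h : P.IsStandardTeleportation φ i f) (hG : G.Connected) :
    2 ≤ T ∧ ∃ M, 1 ≤ M ∧ M ≤ N / 2 ∧ P.HasPairChain i f M := by
  classical
  obtain ⟨s, hs, hmin⟩ : ∃ s, ¬ Disjoint (P.cone f) (P.region i (s + 1)) ∧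
      Disjoint (P.cone f) (P.region i s) := by
    have hex := h.exists_region_meets
    have hpos : Nat.find hex ≠ 0 := fun h0 =>
      Nat.find_spec hex (by rw [h0]; exact h.disjoint_cone_firstBlock hG)
    obtain ⟨s, hs⟩ := Nat.exists_eq_succ_of_ne_zero hpos
    refine ⟨s, ?_, not_not.1 (Nat.find_min hex (by omega))⟩
    have := Nat.find_spec hex
    rwa [hs] at this
  obtain ⟨n, hn, hnf⟩ := P.exists_straddles_of_disjoint i hs hmin
  obtain ⟨q, hq, hqs⟩ : ∃ q, P.site n ≠ P.site q ∧ P.Straddles (P.region i s) q := by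
    obtain ⟨q, q', hqq, hq, hq'⟩ := h.exists_straddling_pair (P.mem_region_self i s) hmin
    by_cases e : P.site n = P.site q
    · exact ⟨q', fun e' => hqq (e.symm.trans e'), hq'⟩
    · exact ⟨q, e, hq⟩
  obtain ⟨m, y, hms, h1, h2, h3, h4, h5⟩ := h.exists_chain hG s hmin ![n, q] hq (by
    intro b
    fin_cases b
    · exact hn
    · exact hqs)
  obtain ⟨r, t, hr, htr, ht⟩ := h.exists_time_eq hn
  have hinj : Function.Injective fun a : Fin (s + 1) × Fin 2 => P.site (m a.1 a.2) := by
    -- A cone used at step `k` lies in every later region, so its site cannot occur in a later pair.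
    have hlt : ∀ k k', k < k' → k' ≤ s → ∀ b b', P.site (m k b) ≠ P.site (m k' b') := by
      intro k k' hk hk' b b' e
      refine (h2 k' hk' b').2 ?_
      rw [← e]
      exact (h2 k (hk.le.trans hk') b).subset_succ.trans (P.region_mono i hk)
    rintro ⟨k, b⟩ ⟨k', b'⟩ e
    have hk := Nat.le_of_lt_succ k.2
    have hk' := Nat.le_of_lt_succ k'.2
    rcases lt_trichotomy (k : ℕ) k' with hlt' | he | hlt'
    · exact absurd e (hlt _ _ hlt' hk' b b')
    · obtain rfl : k = k' := Fin.ext he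
      have hne := h1 k hk
      fin_cases b <;> fin_cases b'
      · rfl
      · exact absurd e hne
      · exact absurd e.symm hne
      · rfl
    · exact absurd e.symm (hlt _ _ hlt' hk b' b)
  refine ⟨by omega, s + 1, Nat.le_add_left 1 s, ?_, fun k b => m k b, fun k b => y k b, hinj,
    fun k b => h3 k (Nat.le_of_lt_succ k.2) b, fun k hk b => ?_, fun k k' hk b => ?_,
    fun k hk => ⟨0, ?_⟩⟩
  · have hinj' : Function.Injective fun a : Fin (s + 1) × Fin 2 => m a.1 a.2 :=
      fun a a' e => hinj (congrArg P.site e)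
    have := Fintype.card_le_of_injective _ hinj'
    simp only [Fintype.card_prod, Fintype.card_fin] at this
    omega
  · dsimp only
    rw [hk]
    exact h4 b
  · dsimp only
    rw [hk]
    exact h5 k (by have := k'.2; omega) b
  · have hks : (k : ℕ) = s := by omega
    dsimp only
    rw [hks]
    have hy := h3 s le_rfl 0
    rw [hms] at hy
    refine (h.dist_final_le hG ht hnf hy).trans ?_
    have := Nat.mul_le_mul_left v htr
    rw [hr, show r + 2 - 1 = r + 1 from rfl, show 2 * (r + 2) - 1 = r + (r + 1) + 2 by omega]
    simp only [Nat.mul_add]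
    omega

end IsStandardTeleportation

/-- Adding up the chain gives `(T - 1) + 2(M - 1)(T - 1) + (2T - 1) = T + 2M(T - 1)` in units of
`v`. -/
theorem HasPairChain.dist_le {P : Protocol G v T N} (hG : G.Connected) {i f : V} {M : ℕ}
    (hM : 1 ≤ M) (hT : 1 ≤ T) (h : P.HasPairChain i f M) :
    G.dist i f ≤ v * T + 2 * v * M * (T - 1) := by
  obtain ⟨m, y, -, -, h1, h2, h3⟩ := h
  have key : ∀ (k : ℕ) (hk : k < M) (b : Fin 2),
      G.dist i (y ⟨k, hk⟩ b) ≤ v * (T - 1) + k * (2 * v * (T - 1)) := by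
    intro k
    induction k with
    | zero => exact fun hk b => by simpa using h1 ⟨0, hk⟩ rfl b
    | succ k ih =>
      intro hk b
      obtain ⟨b', hd⟩ := h2 ⟨k, Nat.lt_of_succ_lt hk⟩ ⟨k + 1, hk⟩ rfl b
      have := ih (Nat.lt_of_succ_lt hk) b'
      rw [Nat.succ_mul, ← add_assoc]
      exact (hG.dist_triangle (v := y ⟨k, _⟩ b')).trans (Nat.add_le_add this hd)
  obtain ⟨k, rfl⟩ := Nat.exists_eq_add_of_le' hM
  obtain ⟨r, rfl⟩ := Nat.exists_eq_add_of_le' hT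
  obtain ⟨b, hb⟩ := h3 ⟨k, Nat.lt_succ_self k⟩ rfl
  have hi := key k (Nat.lt_succ_self k) b
  refine (hG.dist_triangle (v := y _ b)).trans ((Nat.add_le_add hi hb).trans (le_of_eq ?_))
  rw [Nat.add_sub_cancel, show 2 * (r + 1) - 1 = 2 * r + 1 by omega]
  ring

end Protocol

end Teleport

end

/-! ### The theorem. -/

theorem mainTheorem6 {V : Type*} [Fintype V] [DecidableEq V] (G : SimpleGraph V)
    (hG : G.Connected) (v T : ℕ) (i f : V) :
    (∀ (P : Teleport.Protocol G v T 2) (φ : V → Fin 2 → ℂ),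
      P.IsStandardTeleportation φ i f →
      Commute (P.canonicalObs 0) (P.canonicalObs 1) →
      P.canonicalObs 0 ≠ P.canonicalObs 1 →
        2 ≤ T ∧
        (G.dist i f : ℤ) ≤
          v * (3 * T - 2) - 2 * v * max (P.tau 0 : ℤ) (P.tau 1 : ℤ)) ∧
    (∀ (N : ℕ) (P : Teleport.Protocol G v T N) (φ : V → Fin 2 → ℂ),
      P.IsStandardTeleportation φ i f →
        2 ≤ T ∧
        G.dist i f ≤ v * T + 2 * v * (N / 2) * (T - 1) ∧
        ∃ M : ℕ, 1 ≤ M ∧ M ≤ N / 2 ∧ P.HasPairChain i f M) := by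
  refine ⟨fun P φ h _ _ => ?_, fun N P φ h => ?_⟩
  -- The bound `v * T + 2 * v * (time n - 1)` holds for each measurement separately, so the larger
  -- `tau` may be taken.
  · have key : ∀ n, (G.dist i f : ℤ) ≤ v * (3 * T - 2) - 2 * v * (P.tau n : ℤ) := by
      intro n
      have hd := (h.dist_le_of_two_measurements hG n).2
      rw [Teleport.Protocol.tau, Nat.cast_sub (P.time_le n)]
      zify at hd
      linarith
    refine ⟨(h.dist_le_of_two_measurements hG 0).1.trans (P.time_le 0), ?_⟩
    rcases max_choice (P.tau 0 : ℤ) (P.tau 1 : ℤ) with e | e <;> rw [e]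
    · exact key 0
    · exact key 1
  · obtain ⟨hT, M, hM, hMN, hc⟩ := h.exists_hasPairChain hG
    refine ⟨hT, (hc.dist_le hG hM (one_le_two.trans hT)).trans ?_, M, hM, hMN, hc⟩
    gcongr
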